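/- Let $N$ be a non-negative integer, let $\alpha>0$ be real, and let $\eta=(\eta_1,\dots,\eta_N)$ be a composition (a tuple of non-negative integers). **Partial order.** Write $\eta^+$ for the weakly decreasing rearrangement of $\eta$. For compositions $\nu,\eta$ with $\sum_i\nu_i=\sum_i\eta_i$, write $\nu<\eta$ if either $\nu^+\ne\eta^+$ and $\sum_{j\le p}\nu^+_j\le\sum_{j\le p}\eta^+_j$ for all $p=1,\dots,N$, or $\nu^+=\eta^+$, $\nu\neq\eta$ and $\sum_{j\le p}\nu_j\le\sum_{j\le p}\eta_j$ for all $p=1,\dots,N$. **Non-symmetric Jack polynomials.** For $1\le i\le N$ let $$\xi_i=\alpha z_i\frac{\partial}{\partial z_i}+\sum_{p<i}\frac{z_i}{z_i-z_p}(1-s_{ip})+\sum_{p>i}\frac{z_p}{z_i-z_p}(1-s_{ip})+1-i ,$$ where $s_{ip}$ interchanges the variables $z_i$ and $z_p$. The non-symmetric Jack polynomial $E_\eta=E_\eta(z;\alpha)$ is the polynomial in $z_1,\dots,z_N$ with real coefficients of the form $E_\eta=z^\eta+\sum_{\nu<\eta}a_{\eta\nu}z^\nu$ that is an eigenfunction of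 each of $\xi_1,\dots,\xi_N$. **Inner product.** With $z_j=e^{2\pi i x_j}$ and $*$ denoting complex conjugation, put $$\langle f,g\rangle_I=\int_{[0,1]^N}\prod_{1\le j<k\le N}|z_k-z_j|^{2/\alpha}\,f(z_1^*,\dots,z_N^*)\,g(z_1,\dots,z_N)\,dx_1\cdots dx_N,\qquad \mathcal N^{(E)}_\eta=\langle E_\eta,E_\eta\rangle_I .$$ **Constants.** The diagram of $\eta$ is the set of nodes $s=(i,j)$ with $1\le i\le N$, $1\le j\le\eta_i$. For such a node put $a(s)=\eta_i-j$, $a'(s)=j-1$, $$l(s)=\#\{k>i: j\le\eta_k\le\eta_i\}+\#\{k<i: j\le\eta_k+1\le\eta_i\},\qquad l'(s)=\#\{k>i:\eta_k>\eta_i\}+\#\{k<i:\eta_k\ge\eta_i\},$$ and, with the products over all nodes $s$ of the diagram of $\eta$, $$d_\eta=\prod_{s}(\alpha(a(s)+1)+l(s)+1),\qquad d'_\eta=\prod_{s}(\alpha(a(s)+1)+l(s)),$$ $$e_\eta=\prod_{s}(\alpha(a'(s)+1)+N-l'(s)),\qquad e'_\eta=\prod_{s}(\alpha(a'(s)+1)+N-1-l'(s)).$$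 **Proposition.** The polynomial $E_\eta$ exists and is unique, and, with $\mathcal N^{(E)}_0$ the value for $\eta=(0,\dots,0)$, $$\frac{\mathcal N^{(E)}_\eta}{\mathcal N^{(E)}_0}=\frac{d'_\eta\,e_\eta}{d_\eta\,e'_\eta}.$$ -/

import Mathlib

open Finset MeasureTheory

noncomputable section

namespace NonsymJack

variable {N : ℕ}

/-! ### Compositions and their partial order -/

/-- The partition `η⁺` of a composition `η`: its parts in weakly decreasing order. -/
def plus (η : Fin N → ℕ) : Fin N → ℕ := fun i => η (Tuple.sort η (Fin.rev i))

/-- `η⁺` is weakly decreasing. -/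
theorem plus_antitone (η : Fin N → ℕ) : Antitone (plus η) := fun _ _ h =>
  Tuple.monotone_sort η (Fin.rev_le_rev.mpr h)

/-- `PartialSumsLE ν η`: `ν_1 + ⋯ + ν_p ≤ η_1 + ⋯ + η_p` for every `p = 1, …, N`. -/
def PartialSumsLE (ν η : Fin N → ℕ) : Prop :=
  ∀ p : Fin N, ∑ j ∈ Iic p, ν j ≤ ∑ j ∈ Iic p, η j

/-- The strict partial order `ν < η` on compositions of the same modulus: either `ν⁺ < η⁺` in
dominance order, or `ν⁺ = η⁺`, `ν ≠ η` and the partial sums of `ν` are at most those of `η`. -/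
def CompLT (ν η : Fin N → ℕ) : Prop :=
  ∑ i, ν i = ∑ i, η i ∧
    ((plus ν ≠ plus η ∧ PartialSumsLE (plus ν) (plus η)) ∨
      (plus ν = plus η ∧ ν ≠ η ∧ PartialSumsLE ν η))

/-! ### Cherednik operators -/

/-- The operator interchanging the variables `z_i` and `z_p`. -/
def swapVars (i p : Fin N) (f : MvPolynomial (Fin N) ℝ) : MvPolynomial (Fin N) ℝ :=
  MvPolynomial.rename (Equiv.swap i p) f

theorem X_sub_X_dvd_sub_swapVars (i p : Fin N) (f : MvPolynomial (Fin N) ℝ) :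
    (MvPolynomial.X i - MvPolynomial.X p) ∣ f - swapVars i p f := by
  induction f using MvPolynomial.induction_on with
  | C a => simp [swapVars]
  | add f g hf hg =>
    have h : f + g - swapVars i p (f + g) = (f - swapVars i p f) + (g - swapVars i p g) := by
      simp only [swapVars, map_add]; ring
    rw [h]
    exact dvd_add hf hg
  | mul_X f k hf =>
    have hk : (MvPolynomial.X i - MvPolynomial.X p : MvPolynomial (Fin N) ℝ) ∣
        MvPolynomial.X k - MvPolynomial.X (Equiv.swap i p k) := by
      rcases eq_or_ne k i with rfl | hi
      · simp
      · rcases eq_or_ne k p with rfl | hp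
        · rw [Equiv.swap_apply_right, dvd_sub_comm]
        · simp [Equiv.swap_apply_of_ne_of_ne hi hp]
    have h : f * MvPolynomial.X k - swapVars i p (f * MvPolynomial.X k) =
        (f - swapVars i p f) * MvPolynomial.X k +
          swapVars i p f * (MvPolynomial.X k - MvPolynomial.X (Equiv.swap i p k)) := by
      simp only [swapVars, map_mul, MvPolynomial.rename_X]; ring
    rw [h]
    exact dvd_add (hf.mul_right _) (hk.mul_left _)

/-- The polynomial `(f - s_{ip} f) / (z_i - z_p)`, for `i ≠ p`. -/
def divDiff (i p : Fin N) (f : MvPolynomial (Fin N) ℝ) : MvPolynomial (Fin N) ℝ :=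
  Classical.choose (X_sub_X_dvd_sub_swapVars i p f)

theorem X_sub_X_mul_divDiff (i p : Fin N) (f : MvPolynomial (Fin N) ℝ) :
    (MvPolynomial.X i - MvPolynomial.X p) * divDiff i p f = f - swapVars i p f :=
  (Classical.choose_spec (X_sub_X_dvd_sub_swapVars i p f)).symm

/-- The Cherednik operator
`ξ_i = α z_i ∂/∂z_i + ∑_{p<i} z_i/(z_i - z_p) (1 - s_{ip})
  + ∑_{p>i} z_p/(z_i - z_p) (1 - s_{ip}) + 1 - i`.
Here the index runs from `0` to `N - 1`, so that the constant `1 - i` becomes `-i`. -/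
def cherednik (α : ℝ) (i : Fin N) (f : MvPolynomial (Fin N) ℝ) : MvPolynomial (Fin N) ℝ :=
  MvPolynomial.C α * MvPolynomial.X i * MvPolynomial.pderiv i f
    + ∑ p ∈ Iio i, MvPolynomial.X i * divDiff i p f
    + ∑ p ∈ Ioi i, MvPolynomial.X p * divDiff i p f
    - MvPolynomial.C ((i : ℕ) : ℝ) * f

/-! ### Non-symmetric Jack polynomials -/

/-- `E = z^η + ∑_{ν < η} a_ν z^ν`, and `E` is an eigenfunction of every Cherednik operator. -/
structure IsNonsymJack (α : ℝ) (η : Fin N → ℕ) (E : MvPolynomial (Fin N) ℝ) : Prop where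
  coeff_self : E.coeff (Finsupp.equivFunOnFinite.symm η) = 1
  coeff_eq_zero : ∀ ν : Fin N → ℕ, ν ≠ η → ¬ CompLT ν η →
    E.coeff (Finsupp.equivFunOnFinite.symm ν) = 0
  eigen : ∀ i : Fin N, ∃ c : ℝ, cherednik α i E = MvPolynomial.C c * E

/-- The non-symmetric Jack polynomial `E_η(z; α)`: the polynomial with the property
`IsNonsymJack α η`. -/
def jackE (α : ℝ) (η : Fin N → ℕ) : MvPolynomial (Fin N) ℝ :=
  Classical.epsilon (IsNonsymJack α η)

/-! ### The inner product on the torus -/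

/-- The point `(e^{2πi x_1}, …, e^{2πi x_N})` of the torus. -/
def torusPoint (x : Fin N → ℝ) : Fin N → ℂ :=
  fun j => Complex.exp (2 * Real.pi * Complex.I * (x j : ℂ))

/-- `⟨f, g⟩ = ∫_{[0,1]^N} ∏_{j<k} |z_k - z_j|^{2/α} f(z_1^*, …, z_N^*) g(z_1, …, z_N) dx`
with `z_j = e^{2πi x_j}`. -/
def torusInner (α : ℝ) (f g : (Fin N → ℂ) → ℂ) : ℂ :=
  ∫ x in Set.Icc (0 : Fin N → ℝ) 1,
    ((∏ j, ∏ k ∈ Ioi j, ‖torusPoint x k - torusPoint x j‖ ^ (2 / α) : ℝ) : ℂ)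
      * f (fun j => starRingEnd ℂ (torusPoint x j)) * g (torusPoint x)

/-- `𝒩_η = ⟨E_η, E_η⟩`. -/
def jackNorm (α : ℝ) (η : Fin N → ℕ) : ℂ :=
  torusInner α (fun z => MvPolynomial.aeval z (jackE α η))
    (fun z => MvPolynomial.aeval z (jackE α η))

/-! ### Diagram statistics

The diagram of `η` consists of the nodes `(i, j)` with `1 ≤ j ≤ η_i`. -/

/-- Arm length `a(s)`. -/
def arm (η : Fin N → ℕ) (i : Fin N) (j : ℕ) : ℕ := η i - j

/-- Arm colength `a'(s)`. -/
def coarm (j : ℕ) : ℕ := j - 1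

/-- Leg length `l(s)`. -/
def leg (η : Fin N → ℕ) (i : Fin N) (j : ℕ) : ℕ :=
  #{k | i < k ∧ j ≤ η k ∧ η k ≤ η i} + #{k | k < i ∧ j ≤ η k + 1 ∧ η k + 1 ≤ η i}

/-- Leg colength `l'(s)`. -/
def coleg (η : Fin N → ℕ) (i : Fin N) : ℕ :=
  #{k | i < k ∧ η i < η k} + #{k | k < i ∧ η i ≤ η k}

/-- `d_η = ∏_{s ∈ η} (α (a(s) + 1) + l(s) + 1)`. -/
def d (α : ℝ) (η : Fin N → ℕ) : ℝ :=
  ∏ i, ∏ j ∈ Icc 1 (η i), (α * (arm η i j + 1) + leg η i j + 1)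

/-- `d'_η = ∏_{s ∈ η} (α (a(s) + 1) + l(s))`. -/
def d' (α : ℝ) (η : Fin N → ℕ) : ℝ :=
  ∏ i, ∏ j ∈ Icc 1 (η i), (α * (arm η i j + 1) + leg η i j)

/-- `e_η = ∏_{s ∈ η} (α (a'(s) + 1) + N - l'(s))`. -/
def e (α : ℝ) (η : Fin N → ℕ) : ℝ :=
  ∏ i, ∏ j ∈ Icc 1 (η i), (α * (coarm j + 1) + N - coleg η i)

/-- `e'_η = ∏_{s ∈ η} (α (a'(s) + 1) + N - 1 - l'(s))`. -/
def e' (α : ℝ) (η : Fin N → ℕ) : ℝ :=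
  ∏ i, ∏ j ∈ Icc 1 (η i), (α * (coarm j + 1) + N - 1 - coleg η i)

end NonsymJack

end

noncomputable section

namespace NonsymJack

variable {N : ℕ}

open MvPolynomial (X C pderiv rename)

/-! The order on compositions makes every `ξ_i` triangular on monomials, with diagonal entry `eigval
α η i = α η_i - l'` (`cherednik_mono_sub_mem_lower`). The colength `l'` is the rank of `η_i` among
the parts, so the eigenvalue tuple orders the indices in the same way and determines `η`
(`eigval_injective`). A joint eigenfunction with these eigenvalues is therefore determined by its
coefficient at `z^η` (`eq_of_eigen`), which gives uniqueness.

Existence comes from self-adjointness rather than from diagonalizing a commuting family. Let `E` be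
`z^η` minus its orthogonal projection to the span of the lower monomials. That span is
finite-dimensional and stable under `ξ_i`, so `ξ_i E - eigval α η i * E` both lies in it and is
orthogonal to it. It vanishes because the form is positive definite.

Each `ξ_i` is a Heckman operator, which refers to no ordering of the variables, corrected by signed
transpositions (`cherednik_eq_signedOp`). This one decomposition serves twice. It reduces
commutation with permutations and with multiplication by a variable to bookkeeping of signs. It also
reduces self-adjointness to the Heckman operators (`polyInner_heckman`), where it is integration by
parts on the torus. The weight need not be differentiable on the diagonals, so the integration is
done for `|z_j - z_k|² + ε`, followed by a limit `ε → 0`.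

For the norm, two moves generate all compositions from `0`. Replacing `η` by `(η_2, …, η_N, η_1 +
1)` corresponds to an isometry carrying `E_η` to the new polynomial. Interchanging adjacent parts in
descending order, with eigenvalue difference `δ`, gives `E_η = s E_{sη} + δ⁻¹ E_{sη}`, and
orthogonality of `E_η` and `E_{sη}` yields the norm factor `1 - δ⁻²`. The closed form obeys the same
two rules (`normRatio_raiseComp`, `normRatio_comp_swap`), since only one node of the diagram is
affected each time. -/

/-! ### Divided differences -/

theorem X_sub_X_ne_zero {i p : Fin N} (h : i ≠ p) : (X i - X p : MvPolynomial (Fin N) ℝ) ≠ 0 :=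
  sub_ne_zero.mpr fun h' => h (MvPolynomial.X_injective h')

theorem divDiff_eq {i p : Fin N} (h : i ≠ p) {f g : MvPolynomial (Fin N) ℝ}
    (hg : (X i - X p) * g = f - swapVars i p f) : divDiff i p f = g :=
  mul_left_cancel₀ (X_sub_X_ne_zero h) ((X_sub_X_mul_divDiff i p f).trans hg.symm)

theorem swapVars_add (i p : Fin N) (f g : MvPolynomial (Fin N) ℝ) :
    swapVars i p (f + g) = swapVars i p f + swapVars i p g := by simp [swapVars]

theorem swapVars_C_mul (i p : Fin N) (c : ℝ) (f : MvPolynomial (Fin N) ℝ) :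
    swapVars i p (C c * f) = C c * swapVars i p f := by simp [swapVars]

theorem divDiff_add {i p : Fin N} (h : i ≠ p) (f g : MvPolynomial (Fin N) ℝ) :
    divDiff i p (f + g) = divDiff i p f + divDiff i p g :=
  divDiff_eq h (by rw [mul_add, X_sub_X_mul_divDiff, X_sub_X_mul_divDiff, swapVars_add]; ring)

theorem divDiff_C_mul {i p : Fin N} (h : i ≠ p) (c : ℝ) (f : MvPolynomial (Fin N) ℝ) :
    divDiff i p (C c * f) = C c * divDiff i p f :=
  divDiff_eq h (by rw [mul_left_comm, X_sub_X_mul_divDiff, swapVars_C_mul]; ring)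

theorem swapVars_swapVars (i p : Fin N) (f : MvPolynomial (Fin N) ℝ) :
    swapVars i p (swapVars i p f) = f := by
  have h : (Equiv.swap i p : Fin N → Fin N) ∘ (Equiv.swap i p : Fin N → Fin N) = id := by
    funext k; simp
  rw [swapVars, swapVars, MvPolynomial.rename_rename, h, MvPolynomial.rename_id_apply]

/-- Numerator and denominator of the quotient both change sign under the interchange. -/
theorem swapVars_divDiff {i p : Fin N} (h : i ≠ p) (f : MvPolynomial (Fin N) ℝ) :
    swapVars i p (divDiff i p f) = divDiff i p f := by
  refine (divDiff_eq h ?_).symm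
  have h1 := congrArg (swapVars i p) (X_sub_X_mul_divDiff i p f)
  have h2 := swapVars_swapVars i p f
  simp only [swapVars, map_mul, map_sub, MvPolynomial.rename_X, Equiv.swap_apply_left,
    Equiv.swap_apply_right] at h1 h2 ⊢
  rw [h2] at h1
  linear_combination -h1

theorem rename_swapVars (τ : Equiv.Perm (Fin N)) (i p : Fin N) (f : MvPolynomial (Fin N) ℝ) :
    rename τ (swapVars i p f) = swapVars (τ i) (τ p) (rename τ f) := by
  simp only [swapVars, MvPolynomial.rename_rename]
  congr 2
  funext k
  simp only [Function.comp]
  exact (Equiv.swap_apply_apply τ i p ▸ by simp)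

theorem rename_divDiff (τ : Equiv.Perm (Fin N)) {i p : Fin N} (h : i ≠ p)
    (f : MvPolynomial (Fin N) ℝ) :
    rename τ (divDiff i p f) = divDiff (τ i) (τ p) (rename τ f) := by
  refine (divDiff_eq (τ.injective.ne h) ?_).symm
  rw [← rename_swapVars, ← map_sub, ← X_sub_X_mul_divDiff]
  simp

/-! ### Heckman operators and Cherednik operators with a sign function -/

/-- The Heckman operator `α z_i ∂/∂z_i + ½ ∑_{p≠i} (z_i + z_p)/(z_i - z_p) (1 - s_{ip})`. -/
def heckman (α : ℝ) (i : Fin N) (f : MvPolynomial (Fin N) ℝ) : MvPolynomial (Fin N) ℝ :=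
  C α * X i * pderiv i f + C (1 / 2) * ∑ p ∈ {i}ᶜ, (X i + X p) * divDiff i p f

/-- The Heckman operator corrected by the transpositions `s_{ip}` with signs `ε p`. -/
def signedOp (α : ℝ) (ε : Fin N → ℝ) (i : Fin N) (f : MvPolynomial (Fin N) ℝ) :
    MvPolynomial (Fin N) ℝ :=
  heckman α i f - C (1 / 2) * ∑ p ∈ {i}ᶜ, C (ε p) * swapVars i p f - C ((N - 1 : ℝ) / 2) * f

/-- The sign of `i - p`, with value `-1` at `p = i`. -/
def indexSign (i p : Fin N) : ℝ := if p < i then 1 else -1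

theorem compl_singleton_eq (i : Fin N) : ({i}ᶜ : Finset (Fin N)) = Iio i ∪ Ioi i := by
  ext p; simp [lt_or_lt_iff_ne]

theorem sum_compl_singleton {M : Type*} [AddCommMonoid M] (i : Fin N) (g : Fin N → M) :
    ∑ p ∈ {i}ᶜ, g p = ∑ p ∈ Iio i, g p + ∑ p ∈ Ioi i, g p := by
  rw [compl_singleton_eq, sum_union]
  exact disjoint_left.mpr fun p hp hq => by simp at hp hq; exact absurd hp (not_lt.mpr hq.le)

theorem C_half_add_self (f : MvPolynomial (Fin N) ℝ) : C (1 / 2) * f + C (1 / 2) * f = f := by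
  rw [← add_mul, ← map_add]; norm_num

/-- Both `z_i/(z_i - z_p)` and `z_p/(z_i - z_p)` are `½ (z_i + z_p)/(z_i - z_p)`, plus or minus `½`.
The constants add up to `½ i - ½ (N - 1 - i) - i = -(N - 1)/2`, independent of `i`. -/
theorem cherednik_eq_signedOp (α : ℝ) (i : Fin N) (f : MvPolynomial (Fin N) ℝ) :
    cherednik α i f = signedOp α (indexSign i) i f := by
  have hlt : ∀ p ∈ Iio i, X i * divDiff i p f = C (1 / 2) * ((X i + X p) * divDiff i p f)
      - C (1 / 2) * (C (indexSign i p) * swapVars i p f) + C (1 / 2) * f := by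
    intro p hp
    have h := X_sub_X_mul_divDiff i p f
    have h2 := C_half_add_self (X i * divDiff i p f)
    rw [indexSign, if_pos (mem_Iio.mp hp), map_one]
    linear_combination -h2 + C (1 / 2) * h
  have hgt : ∀ p ∈ Ioi i, X p * divDiff i p f = C (1 / 2) * ((X i + X p) * divDiff i p f)
      - C (1 / 2) * (C (indexSign i p) * swapVars i p f) - C (1 / 2) * f := by
    intro p hp
    have h := X_sub_X_mul_divDiff i p f
    have h2 := C_half_add_self (X p * divDiff i p f)
    rw [indexSign, if_neg (not_lt.mpr (mem_Ioi.mp hp).le), map_neg, map_one]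
    linear_combination -h2 - C (1 / 2) * h
  rw [cherednik, signedOp, heckman, sum_compl_singleton, sum_compl_singleton, sum_congr rfl hlt,
    sum_congr rfl hgt]
  simp only [sum_add_distrib, sum_sub_distrib, ← mul_sum, sum_const, Fin.card_Iio, Fin.card_Ioi,
    nsmul_eq_mul]
  have hc : (C ((N - 1 : ℝ) / 2) : MvPolynomial (Fin N) ℝ)
      = C (1 / 2) * ((N - 1 - (i : ℕ) : ℕ) : MvPolynomial (Fin N) ℝ)
        - C (1 / 2) * ((i : ℕ) : MvPolynomial (Fin N) ℝ) + C ((i : ℕ) : ℝ) := by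
    have h1 : (N - 1 - (i : ℕ) : ℕ) = (N : ℝ) - 1 - (i : ℕ) := by
      have := i.2
      rw [Nat.cast_sub (by omega), Nat.cast_sub (by omega)]; simp
    rw [← map_natCast (C : ℝ →+* MvPolynomial (Fin N) ℝ), ← map_natCast (C : ℝ →+* _) (i : ℕ), h1,
      ← map_mul, ← map_mul, ← map_sub, ← map_add]
    congr 1; ring
  rw [hc]
  ring

theorem swapVars_comm (i p : Fin N) (f : MvPolynomial (Fin N) ℝ) :
    swapVars i p f = swapVars p i f := by rw [swapVars, swapVars, Equiv.swap_comm]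

theorem signedOp_add (α : ℝ) (ε : Fin N → ℝ) (i : Fin N) (f g : MvPolynomial (Fin N) ℝ) :
    signedOp α ε i (f + g) = signedOp α ε i f + signedOp α ε i g := by
  have h : ∀ p ∈ ({i}ᶜ : Finset (Fin N)), (X i + X p) * divDiff i p (f + g)
      = (X i + X p) * divDiff i p f + (X i + X p) * divDiff i p g := fun p hp => by
    rw [divDiff_add (by simpa [eq_comm] using hp), mul_add]
  simp only [signedOp, heckman, sum_congr rfl h, swapVars_add, map_add, mul_add, sum_add_distrib]
  ring

theorem signedOp_C_mul (α : ℝ) (ε : Fin N → ℝ) (i : Fin N) (c : ℝ)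
    (f : MvPolynomial (Fin N) ℝ) : signedOp α ε i (C c * f) = C c * signedOp α ε i f := by
  have h : ∀ p ∈ ({i}ᶜ : Finset (Fin N)), (X i + X p) * divDiff i p (C c * f)
      = C c * ((X i + X p) * divDiff i p f) := fun p hp => by
    rw [divDiff_C_mul (by simpa [eq_comm] using hp)]; ring
  have h2 : ∀ p ∈ ({i}ᶜ : Finset (Fin N)), C (ε p) * swapVars i p (C c * f)
      = C c * (C (ε p) * swapVars i p f) := fun p _ => by
    rw [swapVars_C_mul]; ring
  simp only [signedOp, heckman, sum_congr rfl h, sum_congr rfl h2, ← mul_sum,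
    MvPolynomial.pderiv_C_mul]
  ring

theorem pderiv_rename (τ : Equiv.Perm (Fin N)) (i : Fin N) (f : MvPolynomial (Fin N) ℝ) :
    pderiv (τ i) (rename τ f) = rename τ (pderiv i f) :=
  MvPolynomial.pderiv_rename τ.injective i f

theorem sum_compl_singleton_perm {M : Type*} [AddCommMonoid M] (τ : Equiv.Perm (Fin N))
    (i : Fin N) (g : Fin N → M) : ∑ p ∈ {τ i}ᶜ, g p = ∑ p ∈ {i}ᶜ, g (τ p) := by
  refine (sum_nbij' (fun p => τ p) (fun p => τ.symm p) ?_ ?_ ?_ ?_ ?_).symm <;> intro p <;> simp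
  intro h h'
  exact h (by rw [← h']; simp)

theorem rename_heckman (α : ℝ) (τ : Equiv.Perm (Fin N)) (i : Fin N)
    (f : MvPolynomial (Fin N) ℝ) :
    rename τ (heckman α i f) = heckman α (τ i) (rename τ f) := by
  have h : ∀ p ∈ ({i}ᶜ : Finset (Fin N)), rename τ ((X i + X p) * divDiff i p f)
      = (X (τ i) + X (τ p)) * divDiff (τ i) (τ p) (rename τ f) := fun p hp => by
    rw [map_mul, rename_divDiff _ (by simpa [eq_comm] using hp)]; simp
  rw [heckman, heckman, map_add, map_mul, map_mul, map_mul, map_sum, sum_congr rfl h,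
    sum_compl_singleton_perm, pderiv_rename]
  simp

/-- The Heckman part is permutation-equivariant, so conjugation only relabels the signs. -/
theorem rename_signedOp (α : ℝ) (ε : Fin N → ℝ) (τ : Equiv.Perm (Fin N)) (i : Fin N)
    (f : MvPolynomial (Fin N) ℝ) :
    rename τ (signedOp α (ε ∘ τ) i f) = signedOp α ε (τ i) (rename τ f) := by
  rw [signedOp, signedOp, map_sub, map_sub, rename_heckman, map_mul, map_mul, map_sum,
    sum_compl_singleton_perm]
  simp [rename_swapVars]

/-! ### Commutation with multiplication by a variable -/

theorem divDiff_X_mul_of_ne {i p m : Fin N} (h : i ≠ p) (hi : m ≠ i) (hp : m ≠ p)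
    (f : MvPolynomial (Fin N) ℝ) : divDiff i p (X m * f) = X m * divDiff i p f :=
  divDiff_eq h (by
    rw [mul_left_comm, X_sub_X_mul_divDiff]
    simp [swapVars, Equiv.swap_apply_of_ne_of_ne hi hp]; ring)

theorem divDiff_X_right_mul {i m : Fin N} (h : i ≠ m) (f : MvPolynomial (Fin N) ℝ) :
    divDiff i m (X m * f) = X m * divDiff i m f - swapVars i m f :=
  divDiff_eq h (by
    rw [mul_sub, mul_left_comm, X_sub_X_mul_divDiff]
    simp [swapVars]; ring)

theorem divDiff_X_left_mul {m p : Fin N} (h : m ≠ p) (f : MvPolynomial (Fin N) ℝ) :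
    divDiff m p (X m * f) = X m * divDiff m p f + swapVars m p f :=
  divDiff_eq h (by
    rw [mul_add, mul_left_comm, X_sub_X_mul_divDiff]
    simp [swapVars]; ring)

/-- Only the term `p = m` fails to commute with `z_m`. Its defect `-(z_i + z_m) s_{im} f` is exactly
what a change of the sign at `m` produces. -/
theorem signedOp_X_mul_of_ne (α : ℝ) {ε ε' : Fin N → ℝ} {i m : Fin N} (h : i ≠ m)
    (hm : ε m = -1) (hm' : ε' m = 1) (hε : ∀ p, p ≠ m → ε p = ε' p)
    (f : MvPolynomial (Fin N) ℝ) :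
    signedOp α ε i (X m * f) = X m * signedOp α ε' i f := by
  have h1 : ∀ p ∈ ({i}ᶜ : Finset (Fin N)), (X i + X p) * divDiff i p (X m * f)
      = X m * ((X i + X p) * divDiff i p f) - C (ε' p) * (X m * swapVars i p f)
        + C (ε p) * swapVars i p (X m * f) := by
    intro p hp
    have hip : i ≠ p := by simpa [eq_comm] using hp
    rcases eq_or_ne p m with rfl | hpm
    · rw [divDiff_X_right_mul h, hm, hm']
      simp [swapVars]; ring
    · rw [divDiff_X_mul_of_ne hip h.symm hpm.symm, hε p hpm]
      simp [swapVars, Equiv.swap_apply_of_ne_of_ne h.symm hpm.symm]; ring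
  have h2 : pderiv i (X m * f) = X m * pderiv i f := by
    simp [Derivation.leibniz, MvPolynomial.pderiv_X_of_ne h.symm]
  have h3 : ∑ p ∈ {i}ᶜ, C (ε' p) * (X m * swapVars i p f)
      = X m * ∑ p ∈ {i}ᶜ, C (ε' p) * swapVars i p f := by
    rw [mul_sum]; exact sum_congr rfl fun p _ => by ring
  rw [signedOp, signedOp, heckman, heckman, sum_congr rfl h1, h2, sum_add_distrib,
    sum_sub_distrib, h3, ← mul_sum]
  ring

/-- Here every term `p ≠ m` has a defect, so all the signs flip at once; the derivative of `z_m`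
adds `α`. -/
theorem signedOp_X_mul_self (α : ℝ) {ε ε' : Fin N → ℝ} {m : Fin N}
    (hε : ∀ p, p ≠ m → ε p = 1) (hε' : ∀ p, p ≠ m → ε' p = -1) (f : MvPolynomial (Fin N) ℝ) :
    signedOp α ε m (X m * f) = X m * (signedOp α ε' m f + C α * f) := by
  have h1 : ∀ p ∈ ({m}ᶜ : Finset (Fin N)), (X m + X p) * divDiff m p (X m * f)
      = X m * ((X m + X p) * divDiff m p f) - C (ε' p) * (X m * swapVars m p f)
        + C (ε p) * swapVars m p (X m * f) := by
    intro p hp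
    have hip : m ≠ p := by simpa [eq_comm] using hp
    rw [divDiff_X_left_mul hip, hε p hip.symm, hε' p hip.symm]
    simp [swapVars]; ring
  have h2 : pderiv m (X m * f) = X m * pderiv m f + f := by
    simp [Derivation.leibniz]
  have h3 : ∑ p ∈ {m}ᶜ, C (ε' p) * (X m * swapVars m p f)
      = X m * ∑ p ∈ {m}ᶜ, C (ε' p) * swapVars m p f := by
    rw [mul_sum]; exact sum_congr rfl fun p _ => by ring
  rw [signedOp, signedOp, heckman, heckman, sum_congr rfl h1, h2, sum_add_distrib,
    sum_sub_distrib, h3, ← mul_sum]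
  ring

/-! ### Intertwining relations -/

theorem signedOp_congr (α : ℝ) {ε ε' : Fin N → ℝ} {i : Fin N} (h : ∀ p, p ≠ i → ε p = ε' p)
    (f : MvPolynomial (Fin N) ℝ) : signedOp α ε i f = signedOp α ε' i f := by
  rw [signedOp, signedOp, sum_congr rfl fun p hp => by rw [h p (by simpa using hp)]]

theorem signedOp_of_ne_at (α : ℝ) {ε ε' : Fin N → ℝ} {i m : Fin N} (him : m ≠ i)
    (h : ∀ p, p ≠ i → p ≠ m → ε p = ε' p) (f : MvPolynomial (Fin N) ℝ) :
    signedOp α ε i f = signedOp α ε' i f - C ((ε m - ε' m) / 2) * swapVars i m f := by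
  have hm : m ∈ ({i}ᶜ : Finset (Fin N)) := by simpa using him
  have hc : (C ((ε m - ε' m) / 2) : MvPolynomial (Fin N) ℝ)
      = C (1 / 2) * C (ε m) - C (1 / 2) * C (ε' m) := by
    rw [← map_mul, ← map_mul, ← map_sub]; congr 1; ring
  have hs : ∑ p ∈ ({i}ᶜ : Finset (Fin N)).erase m, C (ε p) * swapVars i p f
      = ∑ p ∈ ({i}ᶜ : Finset (Fin N)).erase m, C (ε' p) * swapVars i p f :=
    sum_congr rfl fun p hp => by
      rw [mem_erase] at hp
      rw [h p (by simpa using hp.2) hp.1]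
  rw [signedOp, signedOp, ← add_sum_erase _ _ hm, ← add_sum_erase _ _ hm, hs, hc]
  ring

theorem cherednik_add (α : ℝ) (i : Fin N) (f g : MvPolynomial (Fin N) ℝ) :
    cherednik α i (f + g) = cherednik α i f + cherednik α i g := by
  simp only [cherednik_eq_signedOp, signedOp_add]

theorem cherednik_C_mul (α : ℝ) (i : Fin N) (c : ℝ) (f : MvPolynomial (Fin N) ℝ) :
    cherednik α i (C c * f) = C c * cherednik α i f := by
  simp only [cherednik_eq_signedOp, signedOp_C_mul]

/-- The Cherednik operator as a linear map. -/
def cherednikLin (α : ℝ) (i : Fin N) :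
    MvPolynomial (Fin N) ℝ →ₗ[ℝ] MvPolynomial (Fin N) ℝ where
  toFun := cherednik α i
  map_add' := cherednik_add α i
  map_smul' c f := by
    simp only [MvPolynomial.smul_eq_C_mul, cherednik_C_mul, RingHom.id_apply]

/-- An adjacent transposition reverses the order of no pair of distinct indices other than `{i, k}`.
-/
theorem indexSign_swap_of_ne {i k j p : Fin N} (hk : (k : ℕ) = i + 1)
    (h : ¬(j = i ∧ p = k)) (h' : ¬(j = k ∧ p = i)) :
    indexSign (Equiv.swap i k j) (Equiv.swap i k p) = indexSign j p := by
  simp only [indexSign, Equiv.swap_apply_def, Fin.lt_def, Fin.ext_iff] at *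
  congr 1
  rw [eq_iff_iff]
  split_ifs <;> omega

theorem cherednik_swapVars_of_ne (α : ℝ) {i k j : Fin N} (hk : (k : ℕ) = i + 1) (hi : j ≠ i)
    (hj : j ≠ k) (f : MvPolynomial (Fin N) ℝ) :
    cherednik α j (swapVars i k f) = swapVars i k (cherednik α j f) := by
  have h := rename_signedOp α (indexSign j) (Equiv.swap i k) j f
  rw [Equiv.swap_apply_of_ne_of_ne hi hj] at h
  have h2 : signedOp α (indexSign j ∘ Equiv.swap i k) j f = signedOp α (indexSign j) j f :=
    signedOp_congr α (fun p _ => by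
      have := indexSign_swap_of_ne (p := p) (j := j) hk (by simp [hi]) (by simp [hj])
      rwa [Equiv.swap_apply_of_ne_of_ne hi hj] at this) f
  rw [cherednik_eq_signedOp, cherednik_eq_signedOp, swapVars, swapVars, ← h, h2]

/-- This is a degenerate Hecke relation. Conjugation by `s_{ik}` spoils the sign of the pair `{i,
k}` alone, so the correction is `s_{ik} s_{ik} f = f`. -/
theorem cherednik_swapVars_left (α : ℝ) {i k : Fin N} (hk : (k : ℕ) = i + 1)
    (f : MvPolynomial (Fin N) ℝ) :
    cherednik α i (swapVars i k f) = swapVars i k (cherednik α k f) + f := by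
  have hik : i ≠ k := fun h => by rw [h] at hk; omega
  rw [cherednik_eq_signedOp, cherednik_eq_signedOp]
  have h := rename_signedOp α (indexSign i) (Equiv.swap i k) k f
  rw [Equiv.swap_apply_right] at h
  have h2 := signedOp_of_ne_at α (ε := indexSign i ∘ Equiv.swap i k) (ε' := indexSign k) hik
    (fun p _ hpi => by
      have := indexSign_swap_of_ne (p := p) (j := k) hk (by simp [hik.symm]) (by simp [hpi])
      rwa [Equiv.swap_apply_right] at this) f
  have hs : (indexSign i ∘ Equiv.swap i k) i - indexSign k i = -2 := by
    simp only [indexSign, Function.comp, Equiv.swap_apply_left, Fin.lt_def, hk]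
    norm_num
  rw [hs] at h2
  rw [swapVars, ← h, h2, map_sub, map_mul, swapVars_comm k i]
  change swapVars i k _ - _ * swapVars i k (swapVars i k f) = _
  rw [swapVars_swapVars, MvPolynomial.rename_C]
  norm_num [swapVars]

theorem cherednik_swapVars_right (α : ℝ) {i k : Fin N} (hk : (k : ℕ) = i + 1)
    (f : MvPolynomial (Fin N) ℝ) :
    cherednik α k (swapVars i k f) = swapVars i k (cherednik α i f) - f := by
  have h := congrArg (swapVars i k) (cherednik_swapVars_left α hk (swapVars i k f))
  rw [swapVars_add, swapVars_swapVars, swapVars_swapVars] at h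
  rw [h]; ring

/-- The raising operator `f(z_1, …, z_N) ↦ z_N f(z_N, z_1, …, z_{N-1})`. -/
def raise {n : ℕ} (f : MvPolynomial (Fin (n + 1)) ℝ) : MvPolynomial (Fin (n + 1)) ℝ :=
  X (Fin.last n) * rename (finRotate (n + 1)).symm f

theorem finRotate_symm_zero (n : ℕ) : (finRotate (n + 1)).symm 0 = Fin.last n := by
  rw [Equiv.symm_apply_eq, finRotate_last]

theorem finRotate_symm_succ (n : ℕ) (j : Fin n) : (finRotate (n + 1)).symm j.succ = j.castSucc := by
  rw [Equiv.symm_apply_eq, finRotate_apply, Fin.coeSucc_eq_succ]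

/-- The rotation turns the first index, of sign `1`, into the last, of sign `-1`. Multiplication by
the last variable repairs exactly this sign. -/
theorem cherednik_castSucc_raise {n : ℕ} (α : ℝ) (j : Fin n) (f : MvPolynomial (Fin (n + 1)) ℝ) :
    cherednik α j.castSucc (raise f) = raise (cherednik α j.succ f) := by
  have hne : j.castSucc ≠ Fin.last n := (Fin.castSucc_lt_last j).ne
  have h1 := signedOp_X_mul_of_ne α (ε := indexSign j.castSucc)
    (ε' := Function.update (indexSign j.castSucc) (Fin.last n) 1) hne
    (by simp [indexSign, (Fin.castSucc_lt_last j).le]) (by simp)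
    (fun p hp => by rw [Function.update_of_ne hp]) (rename (finRotate (n + 1)).symm f)
  have h2 := rename_signedOp α (Function.update (indexSign j.castSucc) (Fin.last n) 1)
    (finRotate (n + 1)).symm j.succ f
  rw [finRotate_symm_succ] at h2
  have h3 : signedOp α (Function.update (indexSign j.castSucc) (Fin.last n) 1 ∘
      (finRotate (n + 1)).symm) j.succ f = signedOp α (indexSign j.succ) j.succ f := by
    refine signedOp_congr α (fun p _ => ?_) f
    rw [Function.comp_apply]
    refine Fin.cases ?_ (fun q => ?_) p
    · rw [finRotate_symm_zero, Function.update_self, indexSign, if_pos (Fin.succ_pos j)]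
    · rw [finRotate_symm_succ, Function.update_of_ne (Fin.castSucc_lt_last q).ne]
      simp only [indexSign, Fin.castSucc_lt_castSucc_iff, Fin.succ_lt_succ_iff]
  rw [cherednik_eq_signedOp, cherednik_eq_signedOp, raise, raise, h1, ← h2, h3]

theorem cherednik_last_raise {n : ℕ} (α : ℝ) (f : MvPolynomial (Fin (n + 1)) ℝ) :
    cherednik α (Fin.last n) (raise f) = raise (cherednik α 0 f + C α * f) := by
  have h1 := signedOp_X_mul_self α (ε := indexSign (Fin.last n)) (ε' := fun _ => -1) (m := Fin.last n)
    (fun p hp => by simp [indexSign, Fin.lt_last_iff_ne_last.mpr hp]) (fun _ _ => rfl)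
    (rename (finRotate (n + 1)).symm f)
  have h2 := rename_signedOp α (fun _ => -1) (finRotate (n + 1)).symm 0 f
  rw [finRotate_symm_zero] at h2
  have h3 : signedOp α ((fun _ => -1) ∘ (finRotate (n + 1)).symm) 0 f
      = signedOp α (indexSign 0) 0 f :=
    signedOp_congr α (fun p _ => by simp [indexSign]) f
  rw [cherednik_eq_signedOp, cherednik_eq_signedOp, raise, raise, h1, ← h2, h3, map_add, map_mul,
    MvPolynomial.rename_C]

/-! ### Dominance of rearrangements -/

/-- After removing the common indices, equally many remain on both sides. Those of `S` have values
at most `g p`, the others at least `g p`. -/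
theorem sum_le_sum_Iic_of_antitone {g : Fin N → ℕ} (hg : Antitone g) (p : Fin N)
    {S : Finset (Fin N)} (hS : #S = #(Iic p)) : ∑ j ∈ S, g j ≤ ∑ j ∈ Iic p, g j := by
  rw [← sum_inter_add_sum_sdiff S (Iic p), ← sum_inter_add_sum_sdiff (Iic p) S, inter_comm (Iic p) S]
  have hc : #(S \ Iic p) = #(Iic p \ S) := by
    have h1 := card_sdiff_add_card_inter S (Iic p)
    have h2 := card_sdiff_add_card_inter (Iic p) S
    rw [inter_comm] at h2
    omega
  have h1 : ∑ j ∈ S \ Iic p, g j ≤ #(S \ Iic p) • g p := sum_le_card_nsmul _ _ _ fun j hj => by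
    simp only [mem_sdiff, mem_Iic, not_le] at hj
    exact hg hj.2.le
  have h2 : #(Iic p \ S) • g p ≤ ∑ j ∈ Iic p \ S, g j := card_nsmul_le_sum _ _ _ fun j hj => by
    simp only [mem_sdiff, mem_Iic] at hj
    exact hg hj.1
  rw [hc] at h1
  exact Nat.add_le_add_left (h1.trans h2) _

/-- The permutation that sorts `η` into weakly decreasing order. -/
def plusPerm (η : Fin N → ℕ) : Equiv.Perm (Fin N) := Fin.revPerm.trans (Tuple.sort η)

theorem plus_eq_comp (η : Fin N → ℕ) : plus η = η ∘ plusPerm η := rfl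

theorem plus_comp_perm (η : Fin N → ℕ) (τ : Equiv.Perm (Fin N)) : plus (η ∘ τ) = plus η := by
  funext i
  exact congrFun (Tuple.comp_perm_comp_sort_eq_comp_sort (f := η) (σ := τ)) (Fin.rev i)

theorem sum_plus_comp {M : Type*} [AddCommMonoid M] (g : ℕ → M) (η : Fin N → ℕ) :
    ∑ i, g (plus η i) = ∑ i, g (η i) :=
  Equiv.sum_comp (plusPerm η) fun i => g (η i)

theorem sum_le_sum_plus (η : Fin N → ℕ) (p : Fin N) {S : Finset (Fin N)} (hS : #S = #(Iic p)) :
    ∑ j ∈ S, η j ≤ ∑ j ∈ Iic p, plus η j := by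
  have h : ∑ j ∈ S, η j = ∑ j ∈ S.map (plusPerm η).symm.toEmbedding, plus η j := by
    rw [sum_map]
    exact sum_congr rfl fun j _ => by simp [plus_eq_comp]
  rw [h]
  exact sum_le_sum_Iic_of_antitone (plus_antitone η) p (by rw [card_map, hS])

/-- The partial sums of `plus ν` are the largest sums of `ν` over sets of given size, so dominance
can be tested on arbitrary index sets without sorting. -/
theorem partialSumsLE_plus {μ ν : Fin N → ℕ}
    (h : ∀ S : Finset (Fin N), ∃ T : Finset (Fin N), #T = #S ∧ ∑ j ∈ S, μ j ≤ ∑ j ∈ T, ν j) :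
    PartialSumsLE (plus μ) (plus ν) := by
  intro p
  obtain ⟨T, hT, hle⟩ := h ((Iic p).map (plusPerm μ).toEmbedding)
  rw [card_map] at hT
  rw [sum_map] at hle
  exact hle.trans (sum_le_sum_plus ν p hT)

theorem PartialSumsLE.antisymm {μ ν : Fin N → ℕ} (h : PartialSumsLE μ ν)
    (h' : PartialSumsLE ν μ) : μ = ν := by
  funext p
  induction p using WellFoundedLT.induction with
  | ind p ih =>
    have h1 := le_antisymm (h p) (h' p)
    rw [← Iio_insert, sum_insert (by simp), sum_insert (by simp),
      sum_congr rfl fun j hj => ih j (mem_Iio.mp hj)] at h1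
    exact Nat.add_right_cancel h1

theorem PartialSumsLE.trans {μ ν κ : Fin N → ℕ} (h : PartialSumsLE μ ν)
    (h' : PartialSumsLE ν κ) : PartialSumsLE μ κ := fun p => (h p).trans (h' p)

theorem CompLT.trans {μ ν κ : Fin N → ℕ} (h : CompLT μ ν) (h' : CompLT ν κ) : CompLT μ κ := by
  refine ⟨h.1.trans h'.1, ?_⟩
  rcases h.2 with ⟨h1, h2⟩ | ⟨h1, h2, h3⟩ <;> rcases h'.2 with ⟨h1', h2'⟩ | ⟨h1', h2', h3'⟩
  · refine Or.inl ⟨fun he => h1 (h2.antisymm ?_), h2.trans h2'⟩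
    rw [he]; exact h2'
  · exact Or.inl (h1' ▸ ⟨h1, h2⟩)
  · exact Or.inl (h1 ▸ ⟨h1', h2'⟩)
  · refine Or.inr ⟨h1.trans h1', fun he => h2 (h3.antisymm ?_), h3.trans h3'⟩
    rw [he]; exact h3'

theorem CompLT.irrefl (ν : Fin N → ℕ) : ¬CompLT ν ν := by
  rintro ⟨-, ⟨h, -⟩ | ⟨-, h, -⟩⟩ <;> exact h rfl

/-- The composition `ν` with its entries at `i` and `p` replaced by `c` and `c'`. -/
def update₂ (ν : Fin N → ℕ) (i p : Fin N) (c c' : ℕ) : Fin N → ℕ :=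
  Function.update (Function.update ν i c) p c'

theorem update₂_left (ν : Fin N → ℕ) {i p : Fin N} (h : i ≠ p) (c c' : ℕ) :
    update₂ ν i p c c' i = c := by simp [update₂, h]

theorem update₂_right (ν : Fin N → ℕ) (i p : Fin N) (c c' : ℕ) :
    update₂ ν i p c c' p = c' := by simp [update₂]

theorem update₂_of_ne (ν : Fin N → ℕ) {i p k : Fin N} (hi : k ≠ i) (hp : k ≠ p) (c c' : ℕ) :
    update₂ ν i p c c' k = ν k := by simp [update₂, hi, hp]

theorem sum_eq_pair_add {M : Type*} [AddCommMonoid M] {i p : Fin N} (h : i ≠ p) (g : Fin N → M) :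
    ∑ k, g k = g i + (g p + ∑ k ∈ (univ.erase i).erase p, g k) := by
  rw [add_sum_erase _ _ (by simp [h.symm]), add_sum_erase _ _ (by simp)]

theorem sum_comp_update₂ {M : Type*} [AddCommMonoid M] (ν : Fin N → ℕ) {i p : Fin N} (h : i ≠ p)
    (c c' : ℕ) (g : ℕ → M) : ∑ k, g (update₂ ν i p c c' k)
      = g c + (g c' + ∑ k ∈ (univ.erase i).erase p, g (ν k)) := by
  rw [sum_eq_pair_add h, update₂_left ν h, update₂_right]
  congr 2
  refine sum_congr rfl fun k hk => ?_
  simp only [mem_erase] at hk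
  rw [update₂_of_ne ν hk.2.1 hk.1]

theorem sum_swap_le {μ ν : Fin N → ℕ} {i p : Fin N}
    (hμ : ∀ k, k ≠ i → k ≠ p → μ k = ν k) {S : Finset (Fin N)} (hi : i ∈ S) (hp : p ∉ S)
    (hle : μ i ≤ max (ν i) (ν p)) :
    ∃ T : Finset (Fin N), #T = #S ∧ ∑ j ∈ S, μ j ≤ ∑ j ∈ T, ν j := by
  have hS : ∑ j ∈ S.erase i, μ j = ∑ j ∈ S.erase i, ν j := sum_congr rfl fun k hk => by
    rw [mem_erase] at hk
    exact hμ k hk.1 fun hkp => hp (hkp ▸ hk.2)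
  rcases le_max_iff.mp hle with h1 | h1
  · refine ⟨S, rfl, ?_⟩
    rw [← add_sum_erase _ _ hi, ← add_sum_erase _ _ hi, hS]
    exact Nat.add_le_add_right h1 _
  · have hp' : p ∉ S.erase i := fun hk => hp (mem_of_mem_erase hk)
    refine ⟨insert p (S.erase i), ?_, ?_⟩
    · rw [card_insert_of_notMem hp', card_erase_add_one hi]
    · rw [← add_sum_erase _ _ hi, sum_insert hp', hS]
      exact Nat.add_le_add_right h1 _

/-- Moving two parts closer together with fixed sum lowers a composition in dominance. The
rearrangements differ because the sum of squares, which sorting preserves, strictly drops. -/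
theorem compLT_update₂ {ν : Fin N → ℕ} {i p : Fin N} {c c' : ℕ} (hc : c + c' = ν i + ν p)
    (h1 : ν p < c) (h2 : c < ν i) : CompLT (update₂ ν i p c c') ν := by
  have hip : i ≠ p := fun h => by subst h; omega
  have hsum := sum_comp_update₂ ν hip c c' id
  have hsq := sum_comp_update₂ ν hip c c' fun a => (a : ℤ) ^ 2
  refine ⟨?_, Or.inl ⟨fun he => ?_, partialSumsLE_plus fun S => ?_⟩⟩
  · rw [sum_eq_pair_add hip ν]
    simp only [id] at hsum
    omega
  · have h := sum_plus_comp (fun a => (a : ℤ) ^ 2) (update₂ ν i p c c')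
    rw [he, sum_plus_comp (fun a => (a : ℤ) ^ 2), sum_eq_pair_add hip, hsq] at h
    zify at hc h1 h2
    nlinarith
  · have hμ : ∀ k, k ≠ i → k ≠ p → update₂ ν i p c c' k = ν k := fun k hi hp =>
      update₂_of_ne ν hi hp c c'
    by_cases hi : i ∈ S <;> by_cases hp : p ∈ S
    · refine ⟨S, rfl, le_of_eq ?_⟩
      have hp' : p ∈ S.erase i := mem_erase.mpr ⟨hip.symm, hp⟩
      rw [← add_sum_erase _ _ hi, ← add_sum_erase _ _ hp', ← add_sum_erase _ _ hi,
        ← add_sum_erase _ _ hp', update₂_left ν hip, update₂_right, ← add_assoc, ← add_assoc, hc]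
      congr 1
      refine sum_congr rfl fun k hk => ?_
      simp only [mem_erase] at hk
      exact hμ k hk.2.1 hk.1
    · exact sum_swap_le hμ hi hp (by rw [update₂_left ν hip]; exact le_max_of_le_left h2.le)
    · refine sum_swap_le (fun k h h' => hμ k h' h) hp hi ?_
      rw [update₂_right]
      exact le_max_of_le_right (by omega)
    · refine ⟨S, rfl, le_of_eq (sum_congr rfl fun k hk => hμ k ?_ ?_)⟩ <;> rintro rfl
      exacts [hi hk, hp hk]

theorem compLT_swap {ν : Fin N → ℕ} {i p : Fin N} (hip : i < p) (h : ν p < ν i) :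
    CompLT (ν ∘ Equiv.swap i p) ν := by
  refine ⟨Equiv.sum_comp _ _, Or.inr ⟨plus_comp_perm _ _, fun he => ?_, fun q => ?_⟩⟩
  · have := congrFun he i
    simp at this
    omega
  · rcases lt_or_ge q i with hq | hq
    · refine le_of_eq (sum_congr rfl fun k hk => ?_)
      have hk' := (mem_Iic.mp hk).trans_lt hq
      simp [Equiv.swap_apply_of_ne_of_ne hk'.ne (hk'.trans hip).ne]
    rcases lt_or_ge q p with hq' | hq'
    · refine sum_le_sum fun k hk => ?_
      have hk' := (mem_Iic.mp hk).trans_lt hq'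
      rcases eq_or_ne k i with rfl | hki
      · simp [h.le]
      · simp [Equiv.swap_apply_of_ne_of_ne hki hk'.ne]
    · refine le_of_eq (sum_equiv (Equiv.swap i p) (fun k => ?_) fun k _ => rfl)
      simp only [mem_Iic]
      rcases eq_or_ne k i with rfl | hki
      · simp [hq, hq']
      rcases eq_or_ne k p with rfl | hkp
      · simp [hq, hq']
      rw [Equiv.swap_apply_of_ne_of_ne hki hkp]

/-! ### Triangularity of the Cherednik operators -/

/-- The exponent vector of a composition. -/
abbrev expo (ν : Fin N → ℕ) : Fin N →₀ ℕ := Finsupp.equivFunOnFinite.symm ν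

/-- The monomial `z^ν`. -/
def mono (ν : Fin N → ℕ) : MvPolynomial (Fin N) ℝ := MvPolynomial.monomial (expo ν) 1

theorem coeff_mono (μ ν : Fin N → ℕ) :
    (mono ν).coeff (expo μ) = if ν = μ then (1 : ℝ) else 0 := by
  simp only [mono, MvPolynomial.coeff_monomial, EmbeddingLike.apply_eq_iff_eq]

theorem X_mul_mono (i : Fin N) (ν ν' : Fin N → ℕ) (hi : ν' i = ν i + 1)
    (h : ∀ k, k ≠ i → ν' k = ν k) : X i * mono ν = mono ν' := by
  rw [mono, mono, MvPolynomial.X, MvPolynomial.monomial_mul, one_mul]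
  refine congrArg (fun m => MvPolynomial.monomial m 1) (Finsupp.ext fun k => ?_)
  rcases eq_or_ne k i with rfl | hk
  · simp [hi, add_comm]
  · simp [h k hk, hk]

theorem rename_mono (τ : Equiv.Perm (Fin N)) (ν : Fin N → ℕ) :
    rename τ (mono ν) = mono (ν ∘ τ.symm) := by
  rw [mono, mono, MvPolynomial.rename_monomial]
  refine congrArg (fun m => MvPolynomial.monomial m 1) (Finsupp.ext fun k => ?_)
  have := Finsupp.mapDomain_apply τ.injective (expo ν) (τ.symm k)
  rw [Equiv.apply_symm_apply] at this
  rw [this]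
  rfl

/-- This is the geometric sum `(x^a y^b - x^b y^a)/(x - y) = ∑ x^(b+t) y^(a-1-t)` over `t < a - b`,
checked by telescoping. -/
theorem divDiff_mono {ν : Fin N → ℕ} {i p : Fin N} (h : i ≠ p) (hle : ν p ≤ ν i) :
    divDiff i p (mono ν)
      = ∑ t ∈ range (ν i - ν p), mono (update₂ ν i p (ν p + t) (ν i - 1 - t)) := by
  refine divDiff_eq h ?_
  have hterm : ∀ t ∈ range (ν i - ν p),
      (X i - X p) * mono (update₂ ν i p (ν p + t) (ν i - 1 - t))
        = mono (update₂ ν i p (ν p + (t + 1)) (ν i - (t + 1)))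
          - mono (update₂ ν i p (ν p + t) (ν i - t)) := by
    intro t ht
    rw [mem_range] at ht
    rw [sub_mul]
    congr 1 <;> refine X_mul_mono _ _ _ ?_ fun k hk => ?_
    · simp only [update₂_left ν h]; omega
    · rcases eq_or_ne k p with rfl | hkp
      · simp only [update₂_right]; omega
      · simp only [update₂_of_ne ν hk hkp]
    · simp only [update₂_right]; omega
    · rcases eq_or_ne k i with rfl | hki
      · simp only [update₂_left ν h]
      · simp only [update₂_of_ne ν hki hk]
  rw [mul_sum, sum_congr rfl hterm,
    sum_range_sub fun t => mono (update₂ ν i p (ν p + t) (ν i - t)), swapVars, rename_mono]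
  congr 2 <;> funext k <;> rcases eq_or_ne k i with rfl | hki
  · simp only [update₂_left ν h]; omega
  · rcases eq_or_ne k p with rfl | hkp
    · simp only [update₂_right]; omega
    · simp only [update₂_of_ne ν hki hkp]
  · simp [update₂_left ν h]
  · rcases eq_or_ne k p with rfl | hkp
    · simp [update₂_right]
    · simp [update₂_of_ne ν hki hkp, Equiv.swap_apply_of_ne_of_ne hki hkp]

/-- The span of the monomials `z^ν` with `ν < η`. -/
def lower (η : Fin N → ℕ) : Submodule ℝ (MvPolynomial (Fin N) ℝ) where
  carrier := {f | ∀ ν, ¬CompLT ν η → f.coeff (expo ν) = 0}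
  zero_mem' := fun ν _ => by simp
  add_mem' := fun hf hg ν h => by simp [hf ν h, hg ν h]
  smul_mem' := fun c f hf ν h => by simp [hf ν h]

theorem mono_mem_lower {ν η : Fin N → ℕ} (h : CompLT ν η) : mono ν ∈ lower η := fun μ hμ => by
  rw [coeff_mono, if_neg]
  rintro rfl
  exact hμ h

theorem lower_mono {ν η : Fin N → ℕ} (h : CompLT ν η) : lower ν ≤ lower η := fun _ hf μ hμ =>
  hf μ fun h' => hμ (h'.trans h)

/-- The last term of the geometric sum becomes `z^ν`; in the others the two parts lie strictly
between `ν p` and `ν i`. -/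
theorem X_mul_divDiff_mono_sub_mem_lower {ν : Fin N → ℕ} {i p : Fin N} (h : ν p < ν i) :
    X i * divDiff i p (mono ν) - mono ν ∈ lower ν := by
  have hip : i ≠ p := fun h' => by subst h'; omega
  obtain ⟨n, hn⟩ : ∃ n, ν i - ν p = n + 1 := ⟨ν i - ν p - 1, by omega⟩
  have hX : ∀ t, X i * mono (update₂ ν i p (ν p + t) (ν i - 1 - t))
      = mono (update₂ ν i p (ν p + t + 1) (ν i - 1 - t)) := fun t =>
    X_mul_mono _ _ _ (by simp only [update₂_left ν hip]) fun k hk => by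
      rcases eq_or_ne k p with rfl | hkp
      · simp only [update₂_right]
      · simp only [update₂_of_ne ν hk hkp]
  have hlast : update₂ ν i p (ν p + n + 1) (ν i - 1 - n) = ν := by
    funext k
    rcases eq_or_ne k i with rfl | hki
    · simp only [update₂_left ν hip]; omega
    · rcases eq_or_ne k p with rfl | hkp
      · simp only [update₂_right]; omega
      · simp only [update₂_of_ne ν hki hkp]
  rw [divDiff_mono hip h.le, hn, sum_range_succ, mul_add, hX, hlast, add_sub_cancel_right, mul_sum]
  refine Submodule.sum_mem _ fun t ht => ?_
  rw [mem_range] at ht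
  rw [hX]
  exact mono_mem_lower (compLT_update₂ (by omega) (by omega) (by omega))

/-- The term `t = 0` is now the interchange of the two parts, which is lower because `i < p`; this
is where the second clause of `CompLT` enters. -/
theorem X_mul_divDiff_mono_mem_lower {ν : Fin N → ℕ} {i p : Fin N} (hip : i < p)
    (h : ν p < ν i) : X p * divDiff i p (mono ν) ∈ lower ν := by
  have hX : ∀ t ∈ range (ν i - ν p), X p * mono (update₂ ν i p (ν p + t) (ν i - 1 - t))
      = mono (update₂ ν i p (ν p + t) (ν i - t)) := fun t ht => by
    rw [mem_range] at ht
    refine X_mul_mono _ _ _ (by simp only [update₂_right]; omega) fun k hk => ?_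
    rcases eq_or_ne k i with rfl | hki
    · simp only [update₂_left ν hip.ne]
    · simp only [update₂_of_ne ν hki hk]
  rw [divDiff_mono hip.ne h.le, mul_sum, sum_congr rfl hX]
  refine Submodule.sum_mem _ fun t ht => mono_mem_lower ?_
  rw [mem_range] at ht
  rcases Nat.eq_zero_or_pos t with rfl | ht0
  · convert compLT_swap hip h using 1
    funext k
    rcases eq_or_ne k i with rfl | hki
    · simp [update₂_left ν hip.ne]
    · rcases eq_or_ne k p with rfl | hkp
      · simp [update₂_right]
      · simp [update₂_of_ne ν hki hkp, Equiv.swap_apply_of_ne_of_ne hki hkp]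
  · exact compLT_update₂ (by omega) (by omega) (by omega)

theorem divDiff_comm {i p : Fin N} (h : i ≠ p) (f : MvPolynomial (Fin N) ℝ) :
    divDiff i p f = -divDiff p i f :=
  divDiff_eq h (by
    have := X_sub_X_mul_divDiff p i f
    rw [swapVars_comm] at this
    linear_combination this)

/-- The eigenvalue of the `i`-th Cherednik operator on `E_η`. -/
def eigval (α : ℝ) (η : Fin N → ℕ) (i : Fin N) : ℝ := α * η i - coleg η i

theorem X_mul_pderiv_mono (i : Fin N) (ν : Fin N → ℕ) :
    X i * pderiv i (mono ν) = C (ν i : ℝ) * mono ν := by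
  rw [mono, MvPolynomial.X_mul_pderiv_monomial, MvPolynomial.C_mul_monomial]
  simp [MvPolynomial.smul_monomial]

/-- The colength is spread over the indices `p`, so that each summand is the diagonal entry of one
divided-difference term. -/
theorem eigval_eq (α : ℝ) (η : Fin N → ℕ) (i : Fin N) :
    eigval α η i = α * η i + ∑ p ∈ Iio i, (if η p < η i then 1 else 0)
      + ∑ p ∈ Ioi i, (if η i < η p then -1 else 0) - (i : ℕ) := by
  have h1 : coleg η i = #{k ∈ Ioi i | η i < η k} + #{k ∈ Iio i | ¬η k < η i} := by
    rw [coleg]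
    congr 2 <;> ext k <;> simp
  have h2 := card_filter_add_card_filter_not (s := Iio i) (fun k => η k < η i)
  rw [Fin.card_Iio] at h2
  have h3 : ((i : ℕ) : ℝ) = #{k ∈ Iio i | η k < η i} + #{k ∈ Iio i | ¬η k < η i} := by
    exact_mod_cast h2.symm
  have h4 : ∑ p ∈ Ioi i, (if η i < η p then (-1 : ℝ) else 0) = -#{k ∈ Ioi i | η i < η k} := by
    rw [← sum_filter, sum_const]; simp
  rw [eigval, h1, h3, h4, sum_boole]
  push_cast
  ring

theorem cherednik_mono_sub_mem_lower (α : ℝ) (i : Fin N) (ν : Fin N → ℕ) :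
    cherednik α i (mono ν) - C (eigval α ν i) * mono ν ∈ lower ν := by
  have h1 : ∀ p ∈ Iio i, X i * divDiff i p (mono ν) - C (if ν p < ν i then 1 else 0) * mono ν
      ∈ lower ν := by
    intro p hp
    rw [mem_Iio] at hp
    rcases lt_trichotomy (ν p) (ν i) with h | h | h
    · rw [if_pos h, map_one, one_mul]
      exact X_mul_divDiff_mono_sub_mem_lower h
    · rw [if_neg h.not_lt, divDiff_mono hp.ne' h.le]
      simp [h]
    · rw [if_neg h.not_gt, divDiff_comm hp.ne', map_zero, zero_mul, sub_zero, mul_neg]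
      exact neg_mem (X_mul_divDiff_mono_mem_lower hp h)
  have h2 : ∀ p ∈ Ioi i, X p * divDiff i p (mono ν) - C (if ν i < ν p then -1 else 0) * mono ν
      ∈ lower ν := by
    intro p hp
    rw [mem_Ioi] at hp
    rcases lt_trichotomy (ν p) (ν i) with h | h | h
    · rw [if_neg h.not_gt, map_zero, zero_mul, sub_zero]
      exact X_mul_divDiff_mono_mem_lower hp h
    · rw [if_neg h.not_gt, divDiff_mono hp.ne h.le]
      simp [h]
    · rw [if_pos h, divDiff_comm hp.ne, map_neg, map_one]
      have := neg_mem (X_mul_divDiff_mono_sub_mem_lower h)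
      convert this using 1
      ring
  have h := add_mem (Submodule.sum_mem _ h1) (Submodule.sum_mem _ h2)
  convert h using 1
  rw [cherednik, mul_assoc, X_mul_pderiv_mono, eigval_eq]
  simp only [sum_sub_distrib, ← sum_mul, map_add, map_sub, map_sum, map_mul]
  ring

theorem exists_sum_mono (f : MvPolynomial (Fin N) ℝ) :
    f = ∑ m ∈ f.support, C (f.coeff m) * mono (Finsupp.equivFunOnFinite m) := by
  conv_lhs => rw [f.as_sum]
  refine sum_congr rfl fun m _ => ?_
  rw [mono, MvPolynomial.C_mul_monomial, mul_one, expo, Equiv.symm_apply_apply]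

theorem cherednik_sum {ι : Type*} (α : ℝ) (i : Fin N) (s : Finset ι)
    (f : ι → MvPolynomial (Fin N) ℝ) :
    cherednik α i (∑ k ∈ s, f k) = ∑ k ∈ s, cherednik α i (f k) :=
  map_sum (cherednikLin α i) f s

theorem cherednik_mem_lower {α : ℝ} {η : Fin N → ℕ} (i : Fin N) {f : MvPolynomial (Fin N) ℝ}
    (hf : f ∈ lower η) : cherednik α i f ∈ lower η := by
  rw [exists_sum_mono f, cherednik_sum]
  refine Submodule.sum_mem _ fun m hm => ?_
  rw [cherednik_C_mul, ← MvPolynomial.smul_eq_C_mul]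
  have hlt : CompLT (Finsupp.equivFunOnFinite m) η := by
    by_contra hcon
    exact MvPolynomial.mem_support_iff.mp hm (by simpa [expo] using hf _ hcon)
  refine Submodule.smul_mem _ _ ?_
  have h := add_mem (lower_mono hlt (cherednik_mono_sub_mem_lower α i _))
    (Submodule.smul_mem _ (eigval α (Finsupp.equivFunOnFinite m) i) (mono_mem_lower hlt))
  rwa [MvPolynomial.smul_eq_C_mul, sub_add_cancel] at h

/-- By triangularity only `z^μ` and monomials above it can contribute at `z^μ`, and the latter are
absent. Eigenvalues can thus be read off at a maximal exponent. -/
theorem coeff_cherednik_of_maximal (α : ℝ) (i : Fin N) {f : MvPolynomial (Fin N) ℝ}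
    {μ : Fin N → ℕ} (h : ∀ ν, CompLT μ ν → f.coeff (expo ν) = 0) :
    (cherednik α i f).coeff (expo μ) = eigval α μ i * f.coeff (expo μ) := by
  have hterm : ∀ m ∈ f.support,
      (cherednik α i (C (f.coeff m) * mono (Finsupp.equivFunOnFinite m))).coeff (expo μ)
        = eigval α μ i * (C (f.coeff m) * mono (Finsupp.equivFunOnFinite m)).coeff (expo μ) := by
    intro m hm
    set ν := Finsupp.equivFunOnFinite m with hν
    have hmν : m = expo ν := by simp [hν, expo]
    have hnot : ¬CompLT μ ν := fun hlt =>
      MvPolynomial.mem_support_iff.mp hm (hmν ▸ h ν hlt)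
    have := cherednik_mono_sub_mem_lower α i ν μ hnot
    rw [MvPolynomial.coeff_sub, MvPolynomial.coeff_C_mul, sub_eq_zero] at this
    rw [cherednik_C_mul, MvPolynomial.coeff_C_mul, MvPolynomial.coeff_C_mul, this, coeff_mono]
    split_ifs with hμ
    · rw [hμ]; ring
    · simp
  rw [exists_sum_mono f, cherednik_sum, MvPolynomial.coeff_sum, MvPolynomial.coeff_sum, mul_sum]
  exact sum_congr rfl hterm

open Filter Topology ComplexConjugate

/-! ### Polynomials on the torus -/

/-- The value of a polynomial at a point of the torus. -/
def torusEval (f : MvPolynomial (Fin N) ℝ) (x : Fin N → ℝ) : ℂ :=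
  MvPolynomial.aeval (torusPoint x) f

theorem torusEval_add (f g : MvPolynomial (Fin N) ℝ) (x : Fin N → ℝ) :
    torusEval (f + g) x = torusEval f x + torusEval g x := map_add _ _ _

theorem torusEval_sub (f g : MvPolynomial (Fin N) ℝ) (x : Fin N → ℝ) :
    torusEval (f - g) x = torusEval f x - torusEval g x := map_sub _ _ _

theorem torusEval_mul (f g : MvPolynomial (Fin N) ℝ) (x : Fin N → ℝ) :
    torusEval (f * g) x = torusEval f x * torusEval g x := map_mul _ _ _

theorem torusEval_C (c : ℝ) (x : Fin N → ℝ) : torusEval (C c) x = c :=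
  MvPolynomial.aeval_C _ _

theorem torusEval_X (i : Fin N) (x : Fin N → ℝ) : torusEval (X i) x = torusPoint x i :=
  MvPolynomial.aeval_X _ _

theorem torusEval_rename (τ : Equiv.Perm (Fin N)) (f : MvPolynomial (Fin N) ℝ)
    (x : Fin N → ℝ) : torusEval (rename τ f) x = torusEval f (x ∘ τ) := by
  rw [torusEval, MvPolynomial.aeval_rename]; rfl

theorem torusPoint_mul_conj (x : Fin N → ℝ) (i : Fin N) :
    torusPoint x i * conj (torusPoint x i) = 1 := by
  rw [torusPoint, ← Complex.exp_conj, ← Complex.exp_add]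
  simp [Complex.conj_ofNat]

theorem conj_torusEval (f : MvPolynomial (Fin N) ℝ) (x : Fin N → ℝ) :
    conj (torusEval f x) = MvPolynomial.aeval (fun j => conj (torusPoint x j)) f :=
  MvPolynomial.comp_aeval_apply (torusPoint x) Complex.conjAe.toAlgHom f

theorem contDiff_torusEval (f : MvPolynomial (Fin N) ℝ) :
    ContDiff ℝ 1 fun x => torusEval f x := by
  induction f using MvPolynomial.induction_on with
  | C a => simp only [torusEval_C]; exact contDiff_const
  | add f g hf hg => simp only [torusEval_add]; exact hf.add hg
  | mul_X f k hf =>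
    simp only [torusEval_mul, torusEval_X]
    refine hf.mul ?_
    unfold torusPoint
    exact (contDiff_const.mul (Complex.ofRealCLM.contDiff.comp (contDiff_apply ℝ ℝ k))).cexp

theorem continuous_torusEval (f : MvPolynomial (Fin N) ℝ) :
    Continuous fun x => torusEval f x := (contDiff_torusEval f).continuous

theorem hasDerivAt_torusPoint (x : Fin N → ℝ) (i k : Fin N) (t : ℝ) :
    HasDerivAt (fun t => torusPoint (Function.update x i t) k)
      (if k = i then 2 * Real.pi * Complex.I * torusPoint (Function.update x i t) i else 0) t := by
  unfold torusPoint
  split_ifs with h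
  · subst h
    simp only [Function.update_self]
    have h1 : HasDerivAt (fun t : ℝ => 2 * Real.pi * Complex.I * (t : ℂ))
        (2 * Real.pi * Complex.I * 1) t := (Complex.ofRealCLM.hasDerivAt).const_mul _
    convert h1.cexp using 1
    ring
  · simp only [Function.update_of_ne h]
    exact hasDerivAt_const _ _

/-- In angular coordinates `∂/∂x_i` is `2πi` times the Euler operator `z_i ∂/∂z_i`. -/
theorem hasDerivAt_torusEval (f : MvPolynomial (Fin N) ℝ) (x : Fin N → ℝ) (i : Fin N) (t : ℝ) :
    HasDerivAt (fun t => torusEval f (Function.update x i t))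
      (2 * Real.pi * Complex.I * torusEval (X i * pderiv i f) (Function.update x i t)) t := by
  induction f using MvPolynomial.induction_on with
  | C a => simpa [torusEval_C, torusEval] using hasDerivAt_const t (a : ℂ)
  | add f g hf hg =>
    simp only [torusEval_add, map_add, mul_add] at hf hg ⊢
    exact hf.add hg
  | mul_X f k hf =>
    simp only [torusEval_mul, torusEval_X]
    refine (hf.mul (hasDerivAt_torusPoint x i k t)).congr_deriv ?_
    rw [Derivation.leibniz, torusEval_add, smul_eq_mul, smul_eq_mul, torusEval_mul, torusEval_mul,
      torusEval_mul, torusEval_X, torusEval_X, MvPolynomial.pderiv_X]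
    rcases eq_or_ne k i with rfl | hk
    · simp [torusEval]; ring
    · simp [hk, torusEval]; ring

/-! ### The weight function and its regularization -/

/-- `|z_j - z_k|²` on the torus. -/
def sqDist (x : Fin N → ℝ) (j k : Fin N) : ℝ := 2 - 2 * Real.cos (2 * Real.pi * (x j - x k))

theorem sqDist_comm (x : Fin N → ℝ) (j k : Fin N) : sqDist x j k = sqDist x k j := by
  rw [sqDist, sqDist, ← Real.cos_neg]; ring_nf

theorem sqDist_nonneg (x : Fin N → ℝ) (j k : Fin N) : 0 ≤ sqDist x j k := by
  have := Real.cos_le_one (2 * Real.pi * (x j - x k))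
  rw [sqDist]; linarith

theorem ofReal_sqDist (x : Fin N → ℝ) (j k : Fin N) :
    (sqDist x j k : ℂ) = 2 - torusPoint x j * conj (torusPoint x k)
      - conj (torusPoint x j) * torusPoint x k := by
  rw [sqDist, torusPoint, torusPoint, ← Complex.exp_conj, ← Complex.exp_conj, ← Complex.exp_add,
    ← Complex.exp_add]
  push_cast
  rw [Complex.two_cos]
  simp only [map_mul, Complex.conj_ofReal, Complex.conj_I, map_ofNat]
  rw [sub_add_eq_sub_sub]
  ring_nf

theorem normSq_torusPoint_sub (x : Fin N → ℝ) (j k : Fin N) :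
    ‖torusPoint x j - torusPoint x k‖ ^ 2 = sqDist x j k := by
  have h := Complex.mul_conj' (torusPoint x j - torusPoint x k)
  have hj := torusPoint_mul_conj x j
  have hk := torusPoint_mul_conj x k
  apply Complex.ofReal_injective
  rw [ofReal_sqDist]
  push_cast
  rw [← h, map_sub]
  linear_combination hj + hk

/-- The derivative of `|z_i - z_p|²` along the `i`-th coordinate. -/
def sqDistDeriv (x : Fin N → ℝ) (i p : Fin N) : ℝ :=
  4 * Real.pi * Real.sin (2 * Real.pi * (x i - x p))

theorem sqDistDeriv_comm (x : Fin N → ℝ) (i p : Fin N) :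
    sqDistDeriv x p i = -sqDistDeriv x i p := by
  rw [sqDistDeriv, sqDistDeriv, ← neg_sub (x i), mul_neg, Real.sin_neg, mul_neg]

theorem ofReal_sqDistDeriv (x : Fin N → ℝ) (i p : Fin N) :
    (sqDistDeriv x i p : ℂ) = 2 * Real.pi * Complex.I *
      (conj (torusPoint x i) * torusPoint x p - torusPoint x i * conj (torusPoint x p)) := by
  rw [sqDistDeriv, torusPoint, torusPoint, ← Complex.exp_conj, ← Complex.exp_conj,
    ← Complex.exp_add, ← Complex.exp_add]
  push_cast
  have h := Complex.two_sin (2 * Real.pi * (x i - x p) : ℂ)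
  simp only [map_mul, Complex.conj_ofReal, Complex.conj_I, Complex.conj_ofNat]
  have e1 : 2 * (Real.pi : ℂ) * -Complex.I * (x i : ℂ) + 2 * Real.pi * Complex.I * (x p : ℂ)
      = -(2 * Real.pi * (x i - x p) : ℂ) * Complex.I := by ring
  have e2 : 2 * (Real.pi : ℂ) * Complex.I * (x i : ℂ) + 2 * Real.pi * -Complex.I * (x p : ℂ)
      = (2 * Real.pi * (x i - x p) : ℂ) * Complex.I := by ring
  rw [e1, e2]
  linear_combination 2 * (Real.pi : ℂ) * h

/-- Cleared of denominators, this says that the logarithmic derivative of `|z_i - z_p|²` is `2πi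
(z_i + z_p)/(z_i - z_p)`, the source of the Heckman coefficient. -/
theorem sqDistDeriv_mul_sub (x : Fin N → ℝ) (i p : Fin N) :
    (sqDistDeriv x i p : ℂ) * (torusPoint x i - torusPoint x p)
      = 2 * Real.pi * Complex.I * ((torusPoint x i + torusPoint x p) * sqDist x i p) := by
  rw [ofReal_sqDistDeriv, ofReal_sqDist]
  have hi := torusPoint_mul_conj x i
  have hp := torusPoint_mul_conj x p
  linear_combination 4 * (Real.pi : ℂ) * Complex.I * torusPoint x p * hi
    + 4 * (Real.pi : ℂ) * Complex.I * torusPoint x i * hp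

/-- The regularized weight `∏_{j≠k} (|z_j - z_k|² + ε)^{κ/2}`. -/
def weight (κ ε : ℝ) (x : Fin N → ℝ) : ℝ :=
  ∏ j, ∏ k ∈ {j}ᶜ, (sqDist x j k + ε) ^ (κ / 2)

/-- Each unordered pair occurs twice in `weight`, and `2 · (κ/2)` powers of the squared distance
give `2κ` powers of the distance. -/
theorem prod_norm_rpow_eq_weight (κ : ℝ) (x : Fin N → ℝ) :
    ∏ j, ∏ k ∈ Ioi j, ‖torusPoint x k - torusPoint x j‖ ^ (2 * κ) = weight κ 0 x := by
  have h := prod_prod_Ioi_mul_eq_prod_prod_off_diag fun j k => (sqDist x k j) ^ (κ / 2)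
  rw [weight]
  simp only [add_zero]
  rw [← h]
  refine prod_congr rfl fun j _ => prod_congr rfl fun k _ => ?_
  rw [sqDist_comm x k j, ← Real.mul_rpow (sqDist_nonneg _ _ _) (sqDist_nonneg _ _ _),
    ← normSq_torusPoint_sub, norm_sub_rev, ← pow_add, ← Real.rpow_natCast_mul (norm_nonneg _)]
  congr 1
  push_cast
  ring

theorem weight_nonneg (κ : ℝ) {ε : ℝ} (hε : 0 ≤ ε) (x : Fin N → ℝ) : 0 ≤ weight κ ε x :=
  prod_nonneg fun _ _ => prod_nonneg fun _ _ =>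
    Real.rpow_nonneg (add_nonneg (sqDist_nonneg _ _ _) hε) _

theorem weight_mono {κ : ℝ} (hκ : 0 ≤ κ) {ε ε' : ℝ} (hε : 0 ≤ ε) (h : ε ≤ ε') (x : Fin N → ℝ) :
    weight κ ε x ≤ weight κ ε' x :=
  prod_le_prod (fun _ _ => prod_nonneg fun _ _ =>
    Real.rpow_nonneg (add_nonneg (sqDist_nonneg _ _ _) hε) _) fun j _ =>
    prod_le_prod (fun _ _ => Real.rpow_nonneg (add_nonneg (sqDist_nonneg _ _ _) hε) _)
      fun k _ => Real.rpow_le_rpow (add_nonneg (sqDist_nonneg _ _ _) hε) (by linarith)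
        (by positivity)

theorem contDiff_sqDist (j k : Fin N) : ContDiff ℝ 1 fun x : Fin N → ℝ => sqDist x j k := by
  unfold sqDist
  fun_prop

theorem continuous_sqDist (j k : Fin N) : Continuous fun x : Fin N → ℝ => sqDist x j k :=
  (contDiff_sqDist j k).continuous

theorem continuous_weight {κ : ℝ} (hκ : 0 ≤ κ) (ε : ℝ) :
    Continuous (weight κ ε : (Fin N → ℝ) → ℝ) := by
  unfold weight
  exact continuous_finsetProd _ fun j _ => continuous_finsetProd _ fun k _ =>
    ((continuous_sqDist j k).add continuous_const).rpow_const fun _ => Or.inr (by positivity)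

theorem tendsto_weight {κ : ℝ} (hκ : 0 ≤ κ) (x : Fin N → ℝ) :
    Tendsto (fun n : ℕ => weight κ (1 / ((n : ℝ) + 1)) x) atTop (𝓝 (weight κ 0 x)) := by
  have h : Continuous fun ε => weight κ ε x := by
    unfold weight
    exact continuous_finsetProd _ fun j _ => continuous_finsetProd _ fun k _ =>
      (continuous_const.add continuous_id).rpow_const fun _ => Or.inr (by positivity)
  exact (h.tendsto 0).comp tendsto_one_div_add_atTop_nhds_zero_nat

theorem contDiff_weight (κ : ℝ) {ε : ℝ} (hε : 0 < ε) :
    ContDiff ℝ 1 (weight κ ε : (Fin N → ℝ) → ℝ) := by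
  unfold weight
  exact contDiff_prod fun j _ => contDiff_prod fun k _ =>
    ((contDiff_sqDist j k).add contDiff_const).rpow_const_of_ne fun x =>
      (add_pos_of_nonneg_of_pos (sqDist_nonneg x j k) hε).ne'

theorem weight_comp_perm (κ ε : ℝ) (τ : Equiv.Perm (Fin N)) (x : Fin N → ℝ) :
    weight κ ε (x ∘ τ) = weight κ ε x := by
  rw [weight, weight,
    ← Equiv.prod_comp τ fun j => ∏ k ∈ {j}ᶜ, (sqDist x j k + ε) ^ (κ / 2)]
  refine prod_congr rfl fun j _ => ?_
  refine prod_nbij' (fun k => τ k) (fun k => τ.symm k) ?_ ?_ ?_ ?_ ?_ <;> intro k <;>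
    simp [sqDist]
  rintro h rfl
  exact h (τ.apply_symm_apply k).symm

theorem hasDerivAt_sqDist (x : Fin N → ℝ) {j k : Fin N} (hjk : j ≠ k) (i : Fin N) (t : ℝ) :
    HasDerivAt (fun t => sqDist (Function.update x i t) j k)
      ((if j = i then sqDistDeriv (Function.update x i t) i k else 0)
        + if k = i then sqDistDeriv (Function.update x i t) i j else 0) t := by
  have key : ∀ {j k : Fin N}, j ≠ k → j = i →
      HasDerivAt (fun t => sqDist (Function.update x i t) j k)
        (sqDistDeriv (Function.update x i t) i k) t := by
    rintro j k hjk rfl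
    simp only [sqDist, sqDistDeriv, Function.update_self, Function.update_of_ne hjk.symm]
    have h := ((((hasDerivAt_id t).sub_const (x k)).const_mul (2 * Real.pi)).cos.const_mul
      2).const_sub 2
    refine h.congr_deriv ?_
    simp only [id]
    ring
  rcases eq_or_ne j i with hj | hj
  · have hk : k ≠ i := fun h => hjk (hj.trans h.symm)
    rw [if_pos hj, if_neg hk, add_zero]
    exact key hjk hj
  rcases eq_or_ne k i with hk | hk
  · rw [if_pos hk, if_neg hj, zero_add]
    simp only [sqDist_comm _ j k]
    exact key hjk.symm hk
  · rw [if_neg hj, if_neg hk, add_zero]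
    simp only [sqDist, Function.update_of_ne hj, Function.update_of_ne hk]
    exact hasDerivAt_const _ _

theorem weight_eq_exp (κ : ℝ) {ε : ℝ} (hε : 0 < ε) (x : Fin N → ℝ) :
    weight κ ε x = Real.exp (∑ j, ∑ k ∈ {j}ᶜ, Real.log (sqDist x j k + ε) * (κ / 2)) := by
  rw [weight, Real.exp_sum]
  refine prod_congr rfl fun j _ => ?_
  rw [Real.exp_sum]
  exact prod_congr rfl fun k _ =>
    Real.rpow_def_of_pos (add_pos_of_nonneg_of_pos (sqDist_nonneg x j k) hε) _

theorem hasDerivAt_weight (κ : ℝ) {ε : ℝ} (hε : 0 < ε) (x : Fin N → ℝ) (i : Fin N) (t : ℝ) :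
    HasDerivAt (fun t => weight κ ε (Function.update x i t))
      (weight κ ε (Function.update x i t) * (κ * ∑ p ∈ {i}ᶜ,
        sqDistDeriv (Function.update x i t) i p / (sqDist (Function.update x i t) i p + ε))) t := by
  set y := Function.update x i t with hy
  have hlog : ∀ j, ∀ k ∈ ({j}ᶜ : Finset (Fin N)),
      HasDerivAt (fun t => Real.log (sqDist (Function.update x i t) j k + ε) * (κ / 2))
        (((if j = i then sqDistDeriv y i k else 0) + if k = i then sqDistDeriv y i j else 0)
          / (sqDist y j k + ε) * (κ / 2)) t := fun j k hk =>
    (((hasDerivAt_sqDist x (by simpa [eq_comm] using hk) i t).add_const ε).log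
      (add_pos_of_nonneg_of_pos (sqDist_nonneg _ j k) hε).ne').mul_const _
  have h := (HasDerivAt.fun_sum fun j (_ : j ∈ univ) => HasDerivAt.fun_sum (hlog j)).exp
  simp only [← weight_eq_exp κ hε] at h
  refine h.congr_deriv ?_
  congr 1
  simp only [← sum_mul, add_div, sum_add_distrib]
  have h1 : ∑ j, ∑ k ∈ {j}ᶜ, (if j = i then sqDistDeriv y i k else 0) / (sqDist y j k + ε)
      = ∑ p ∈ {i}ᶜ, sqDistDeriv y i p / (sqDist y i p + ε) := by
    rw [sum_eq_single i (fun j _ hj => by simp [hj]) (by simp)]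
    simp
  have h2 : ∑ j, ∑ k ∈ {j}ᶜ, (if k = i then sqDistDeriv y i j else 0) / (sqDist y j k + ε)
      = ∑ p ∈ {i}ᶜ, sqDistDeriv y i p / (sqDist y i p + ε) := by
    rw [sum_comm' (t' := univ) (s' := fun k => {k}ᶜ) (by simp [eq_comm])]
    rw [sum_eq_single i (fun j _ hj => by simp [hj]) (by simp)]
    exact sum_congr rfl fun p _ => by rw [if_pos rfl, sqDist_comm]
  rw [h1, h2]
  ring

/-! ### Integration over the unit cube -/

theorem setIntegral_cube_comp_perm (τ : Equiv.Perm (Fin N)) (G : (Fin N → ℝ) → ℂ) :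
    ∫ x in Set.Icc (0 : Fin N → ℝ) 1, G (x ∘ τ) = ∫ x in Set.Icc (0 : Fin N → ℝ) 1, G x := by
  have h := (volume_measurePreserving_piCongrLeft (fun _ : Fin N => ℝ) τ.symm)
  have hfun : ∀ x : Fin N → ℝ, MeasurableEquiv.piCongrLeft (fun _ : Fin N => ℝ) τ.symm x
      = x ∘ τ := fun x => by
    funext k
    have := MeasurableEquiv.piCongrLeft_apply_apply (β := fun _ : Fin N => ℝ) τ.symm x (τ k)
    rwa [Equiv.symm_apply_apply] at this
  rw [← h.setIntegral_preimage_emb (MeasurableEquiv.measurableEmbedding _) G]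
  have hset : (MeasurableEquiv.piCongrLeft (fun _ : Fin N => ℝ) τ.symm) ⁻¹'
      Set.Icc (0 : Fin N → ℝ) 1 = Set.Icc 0 1 := by
    ext x
    rw [Set.mem_preimage, hfun, Set.mem_Icc, Set.mem_Icc]
    simp only [Pi.le_def, Function.comp, Pi.zero_apply, Pi.one_apply]
    rw [τ.forall_congr_right (q := fun k => 0 ≤ x k), τ.forall_congr_right (q := fun k => x k ≤ 1)]
  rw [hset]
  simp only [hfun]

/-- The divergence theorem is applied to the field with `G` as its only component; the opposite
faces cancel by periodicity. -/
theorem setIntegral_cube_eq_zero_of_periodic {n : ℕ} (i : Fin (n + 1))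
    {G G' : (Fin (n + 1) → ℝ) → ℂ} (hG : ContDiff ℝ 1 G)
    (hG' : ∀ x, HasDerivAt (fun t => G (Function.update x i t)) (G' x) (x i))
    (hper : ∀ x, G (Function.update x i 1) = G (Function.update x i 0)) :
    ∫ x in Set.Icc (0 : Fin (n + 1) → ℝ) 1, G' x = 0 := by
  have hfd : ∀ x, HasFDerivAt G (fderiv ℝ G x) x := fun x =>
    (hG.differentiable one_ne_zero x).hasFDerivAt
  have hG'eq : ∀ x, fderiv ℝ G x (Pi.single i 1) = G' x := fun x => by
    have h1 : HasFDerivAt G (fderiv ℝ G x) (Function.update x i (x i)) := by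
      rw [Function.update_eq_self]; exact hfd x
    exact (h1.comp_hasDerivAt (x i) (hasDerivAt_update x i (x i))).unique (hG' x)
  have hcont : Continuous fun x => fderiv ℝ G x (Pi.single i 1) :=
    (hG.continuous_fderiv one_ne_zero).clm_apply continuous_const
  have hsum : ∀ x : Fin (n + 1) → ℝ, ∑ j, (if j = i then fderiv ℝ G x else 0) (Pi.single j 1)
      = G' x := fun x => by
    rw [sum_eq_single i (fun j _ hj => by simp [hj]) (by simp), if_pos rfl, hG'eq]
  have h := integral_divergence_of_hasFDerivAt_off_countable' (0 : Fin (n + 1) → ℝ) 1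
    zero_le_one (fun j x => if j = i then G x else 0)
    (fun j x => if j = i then fderiv ℝ G x else 0) ∅ Set.countable_empty
    (fun j => by
      split_ifs
      exacts [hG.continuous.continuousOn, continuousOn_const])
    (fun x _ j => by
      split_ifs
      exacts [hfd x, hasFDerivAt_const _ _])
    (by
      simp only [hsum, ← hG'eq]
      exact hcont.integrableOn_Icc)
  simp only [hsum] at h
  rw [h]
  refine sum_eq_zero fun j _ => ?_
  rcases eq_or_ne j i with rfl | hj
  · have : ∀ y : Fin n → ℝ, G (j.insertNth 1 y) = G (j.insertNth 0 y) := fun y => by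
      have := hper (j.insertNth 0 y)
      rwa [Fin.update_insertNth, Fin.update_insertNth] at this
    simp [this]
  · simp [hj]

/-! ### Self-adjointness of the Heckman operators -/

/-- The Hermitian product of the values of two polynomials. -/
def hermProd (f g : MvPolynomial (Fin N) ℝ) (x : Fin N → ℝ) : ℂ :=
  conj (torusEval f x) * torusEval g x

theorem contDiff_hermProd (f g : MvPolynomial (Fin N) ℝ) :
    ContDiff ℝ 1 fun x => hermProd f g x :=
  (Complex.conjCLE.contDiff.comp (contDiff_torusEval f)).mul (contDiff_torusEval g)

theorem continuous_hermProd (f g : MvPolynomial (Fin N) ℝ) :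
    Continuous fun x => hermProd f g x := (contDiff_hermProd f g).continuous

theorem torusEval_swapVars (i p : Fin N) (f : MvPolynomial (Fin N) ℝ) (x : Fin N → ℝ) :
    torusEval (swapVars i p f) x = torusEval f (x ∘ Equiv.swap i p) := torusEval_rename _ f x

/-- The operator `(z_i + z_p)/(z_i - z_p) (1 - s_{ip})`. -/
def pairOp (i p : Fin N) (f : MvPolynomial (Fin N) ℝ) : MvPolynomial (Fin N) ℝ :=
  (X i + X p) * divDiff i p f

theorem swapVars_pairOp {i p : Fin N} (h : i ≠ p) (f : MvPolynomial (Fin N) ℝ) :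
    swapVars i p (pairOp i p f) = pairOp i p f := by
  have h1 : swapVars i p (pairOp i p f) = (X p + X i) * swapVars i p (divDiff i p f) := by
    simp [pairOp, swapVars]
  rw [h1, swapVars_divDiff h, pairOp, add_comm]

theorem torusEval_sub_swap (i p : Fin N) (f : MvPolynomial (Fin N) ℝ) (x : Fin N → ℝ) :
    torusEval f x - torusEval (swapVars i p f) x
      = (torusPoint x i - torusPoint x p) * torusEval (divDiff i p f) x := by
  rw [← torusEval_sub, ← X_sub_X_mul_divDiff, torusEval_mul, torusEval_sub, torusEval_X,
    torusEval_X]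

theorem torusEval_pairOp (i p : Fin N) (f : MvPolynomial (Fin N) ℝ) (x : Fin N → ℝ) :
    torusEval (pairOp i p f) x
      = (torusPoint x i + torusPoint x p) * torusEval (divDiff i p f) x := by
  rw [pairOp, torusEval_mul, torusEval_add, torusEval_X, torusEval_X]

/-- With `s = s_{ip}`, the difference is `f* (g - sg) + (f - sf)* sg`. Each summand contains `z_i -
z_p` or its conjugate, which turns `sqDistDeriv` into a multiple of `sqDist`. -/
theorem sqDistDeriv_mul_hermProd_sub (i p : Fin N) (f g : MvPolynomial (Fin N) ℝ)
    (x : Fin N → ℝ) :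
    (sqDistDeriv x i p : ℂ) * (hermProd f g x - hermProd (swapVars i p f) (swapVars i p g) x)
      = 2 * Real.pi * Complex.I * (sqDist x i p *
        (hermProd f (pairOp i p g) x - hermProd (pairOp i p f) (swapVars i p g) x)) := by
  have h1 := sqDistDeriv_mul_sub x i p
  have h2 := congrArg conj h1
  have hf := congrArg conj (torusEval_sub_swap i p f x)
  have hg := torusEval_sub_swap i p g x
  simp only [map_mul, map_sub, map_add, Complex.conj_ofReal, Complex.conj_I, Complex.conj_ofNat]
    at h2 hf
  simp only [hermProd, torusEval_pairOp, map_mul, map_add]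
  linear_combination (sqDistDeriv x i p : ℂ) * conj (torusEval f x) * hg
    + (sqDistDeriv x i p : ℂ) * torusEval (swapVars i p g) x * hf
    + conj (torusEval f x) * torusEval (divDiff i p g) x * h1
    + conj (torusEval (divDiff i p f) x) * torusEval (swapVars i p g) x * h2

theorem continuous_ofReal_weight {κ : ℝ} (hκ : 0 ≤ κ) (ε : ℝ) :
    Continuous fun x : Fin N → ℝ => (weight κ ε x : ℂ) :=
  Complex.continuous_ofReal.comp (continuous_weight hκ ε)

theorem continuous_sqDistDeriv (i p : Fin N) :
    Continuous fun x : Fin N → ℝ => sqDistDeriv x i p := by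
  unfold sqDistDeriv
  fun_prop

theorem sqDist_add_ne_zero (x : Fin N → ℝ) (i p : Fin N) {ε : ℝ} (hε : 0 < ε) :
    sqDist x i p + ε ≠ 0 := (add_pos_of_nonneg_of_pos (sqDist_nonneg x i p) hε).ne'

theorem continuous_sqDistDeriv_div (i p : Fin N) {ε : ℝ} (hε : 0 < ε) :
    Continuous fun x : Fin N → ℝ => ((sqDistDeriv x i p / (sqDist x i p + ε) : ℝ) : ℂ) :=
  Complex.continuous_ofReal.comp ((continuous_sqDistDeriv i p).div
    ((continuous_sqDist i p).add continuous_const) fun x => sqDist_add_ne_zero x i p hε)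

theorem continuous_sqDist_div (i p : Fin N) {ε : ℝ} (hε : 0 < ε) :
    Continuous fun x : Fin N → ℝ => ((sqDist x i p / (sqDist x i p + ε) : ℝ) : ℂ) :=
  Complex.continuous_ofReal.comp ((continuous_sqDist i p).div
    ((continuous_sqDist i p).add continuous_const) fun x => sqDist_add_ne_zero x i p hε)

/-- The symmetrized boundary term for the pair `i, p`. -/
def pairForm (i p : Fin N) (f g : MvPolynomial (Fin N) ℝ) (x : Fin N → ℝ) : ℂ :=
  hermProd f (pairOp i p g) x - hermProd (pairOp i p f) (swapVars i p g) x

theorem continuous_pairForm (i p : Fin N) (f g : MvPolynomial (Fin N) ℝ) :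
    Continuous fun x => pairForm i p f g x :=
  (continuous_hermProd _ _).sub (continuous_hermProd _ _)

theorem hermProd_comp_swap (i p : Fin N) (f g : MvPolynomial (Fin N) ℝ) (x : Fin N → ℝ) :
    hermProd f g (x ∘ Equiv.swap i p) = hermProd (swapVars i p f) (swapVars i p g) x := by
  simp only [hermProd, torusEval_swapVars]

theorem sqDist_comp_swap (x : Fin N → ℝ) (i p : Fin N) :
    sqDist (x ∘ Equiv.swap i p) i p = sqDist x i p := by
  rw [sqDist_comm x i p]; simp [sqDist]

theorem sqDistDeriv_comp_swap (x : Fin N → ℝ) (i p : Fin N) :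
    sqDistDeriv (x ∘ Equiv.swap i p) i p = -sqDistDeriv x i p := by
  rw [← sqDistDeriv_comm]; simp [sqDistDeriv]

/-- The logarithmic derivative is odd under `x_i ↔ x_p` and the weight is even. Averaging the
integrand with its interchange replaces a factor singular as `ε → 0` by the ratio `sqDist / (sqDist
+ ε)`, which stays in `[0, 1]`. -/
theorem setIntegral_sqDistDeriv_div {κ : ℝ} (hκ : 0 ≤ κ) {ε : ℝ} (hε : 0 < ε) (i p : Fin N)
    (f g : MvPolynomial (Fin N) ℝ) :
    ∫ x in Set.Icc (0 : Fin N → ℝ) 1, (weight κ ε x : ℂ)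
        * (((sqDistDeriv x i p / (sqDist x i p + ε) : ℝ) : ℂ) * hermProd f g x)
      = 2 * Real.pi * Complex.I * ∫ x in Set.Icc (0 : Fin N → ℝ) 1, (weight κ ε x : ℂ)
        * ((1 / 2) * (((sqDist x i p / (sqDist x i p + ε) : ℝ) : ℂ) * pairForm i p f g x)) := by
  set A : (Fin N → ℝ) → ℂ := fun x => (weight κ ε x : ℂ)
        * (((sqDistDeriv x i p / (sqDist x i p + ε) : ℝ) : ℂ) * hermProd f g x) with hA
  have hAc : Continuous A := (continuous_ofReal_weight hκ ε).mul
    ((continuous_sqDistDeriv_div i p hε).mul (continuous_hermProd f g))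
  have hAs : Continuous fun x => A (x ∘ Equiv.swap i p) :=
    hAc.comp (continuous_pi fun k => continuous_apply _)
  have h1 := setIntegral_cube_comp_perm (Equiv.swap i p) A
  have h2 : ∫ x in Set.Icc (0 : Fin N → ℝ) 1, (A x + A (x ∘ Equiv.swap i p))
      = (∫ x in Set.Icc (0 : Fin N → ℝ) 1, A x) + ∫ x in Set.Icc (0 : Fin N → ℝ) 1, A x := by
    rw [integral_add hAc.integrableOn_Icc hAs.integrableOn_Icc, h1]
  have h3 : ∫ x in Set.Icc (0 : Fin N → ℝ) 1, A x
      = ∫ x in Set.Icc (0 : Fin N → ℝ) 1, (1 / 2 : ℂ) * (A x + A (x ∘ Equiv.swap i p)) := by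
    rw [integral_const_mul, h2]; ring
  rw [h3, ← integral_const_mul]
  congr 1
  funext x
  have h := sqDistDeriv_mul_hermProd_sub i p f g x
  have hne : ((sqDist x i p : ℂ) + ε) ≠ 0 := by
    exact_mod_cast sqDist_add_ne_zero x i p hε
  simp only [hA, weight_comp_perm, sqDist_comp_swap, sqDistDeriv_comp_swap, hermProd_comp_swap,
    pairForm]
  push_cast
  field_simp
  linear_combination (weight κ ε x : ℂ) * h

theorem hasDerivAt_hermProd (f g : MvPolynomial (Fin N) ℝ) (x : Fin N → ℝ) (i : Fin N) (t : ℝ) :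
    HasDerivAt (fun t => hermProd f g (Function.update x i t))
      (2 * Real.pi * Complex.I * (hermProd f (X i * pderiv i g) (Function.update x i t)
        - hermProd (X i * pderiv i f) g (Function.update x i t))) t := by
  have h1 : HasDerivAt (fun t => conj (torusEval f (Function.update x i t)))
      (conj (2 * Real.pi * Complex.I * torusEval (X i * pderiv i f) (Function.update x i t))) t :=
    Complex.conjCLE.toContinuousLinearMap.hasFDerivAt.comp_hasDerivAt t
      (hasDerivAt_torusEval f x i t)
  refine (h1.mul (hasDerivAt_torusEval g x i t)).congr_deriv ?_
  simp only [hermProd, map_mul, Complex.conj_ofReal, Complex.conj_I, Complex.conj_ofNat]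
  ring

theorem torusPoint_update_one (x : Fin N → ℝ) (i : Fin N) :
    torusPoint (Function.update x i 1) = torusPoint (Function.update x i 0) := by
  funext k
  rcases eq_or_ne k i with rfl | hk
  · simp [torusPoint, Complex.exp_two_pi_mul_I]
  · simp [torusPoint, hk]

theorem sqDist_congr {x y : Fin N → ℝ} (h : torusPoint x = torusPoint y) (j k : Fin N) :
    sqDist x j k = sqDist y j k := by
  rw [← normSq_torusPoint_sub, ← normSq_torusPoint_sub, h]

theorem setIntegral_regularized_eq_zero {κ : ℝ} (hκ : 0 ≤ κ) {ε : ℝ} (hε : 0 < ε) (i : Fin N)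
    (f g : MvPolynomial (Fin N) ℝ) :
    ∫ x in Set.Icc (0 : Fin N → ℝ) 1, (weight κ ε x : ℂ)
      * (hermProd f (X i * pderiv i g) x - hermProd (X i * pderiv i f) g x
        + κ * ∑ p ∈ {i}ᶜ, (1 / 2) * (((sqDist x i p / (sqDist x i p + ε) : ℝ) : ℂ)
          * pairForm i p f g x)) = 0 := by
  obtain ⟨n, rfl⟩ : ∃ n, N = n + 1 := ⟨N - 1, by have := i.2; omega⟩
  have hper : ∀ x : Fin (n + 1) → ℝ,
      (weight κ ε (Function.update x i 1) : ℂ) * hermProd f g (Function.update x i 1)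
        = (weight κ ε (Function.update x i 0) : ℂ) * hermProd f g (Function.update x i 0) :=
    fun x => by
      have h := torusPoint_update_one x i
      simp only [weight, hermProd, torusEval, sqDist_congr h, h]
  have h := setIntegral_cube_eq_zero_of_periodic i
    ((Complex.ofRealCLM.contDiff.comp (contDiff_weight κ hε)).mul (contDiff_hermProd f g))
    (fun x => (hasDerivAt_weight κ hε x i (x i)).ofReal_comp.mul
      (hasDerivAt_hermProd f g x i (x i))) hper
  simp only [Function.update_eq_self] at h
  set D : (Fin (n + 1) → ℝ) → ℂ := fun x =>
    hermProd f (X i * pderiv i g) x - hermProd (X i * pderiv i f) g x with hD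
  have hDc : Continuous fun x => (weight κ ε x : ℂ) * D x :=
    (continuous_ofReal_weight hκ ε).mul ((continuous_hermProd _ _).sub (continuous_hermProd _ _))
  set S : Fin (n + 1) → (Fin (n + 1) → ℝ) → ℂ := fun p x => (weight κ ε x : ℂ)
        * (((sqDistDeriv x i p / (sqDist x i p + ε) : ℝ) : ℂ) * hermProd f g x) with hS
  have hSc : ∀ p, Continuous (S p) := fun p => (continuous_ofReal_weight hκ ε).mul
    ((continuous_sqDistDeriv_div i p hε).mul (continuous_hermProd f g))
  set T : Fin (n + 1) → (Fin (n + 1) → ℝ) → ℂ := fun p x => (weight κ ε x : ℂ)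
        * ((1 / 2) * (((sqDist x i p / (sqDist x i p + ε) : ℝ) : ℂ) * pairForm i p f g x)) with hT
  have hTc : ∀ p, Continuous (T p) := fun p => (continuous_ofReal_weight hκ ε).mul
    (continuous_const.mul ((continuous_sqDist_div i p hε).mul (continuous_pairForm i p f g)))
  have hST : ∀ p, ∫ x in Set.Icc (0 : Fin (n + 1) → ℝ) 1, S p x
      = 2 * Real.pi * Complex.I * ∫ x in Set.Icc (0 : Fin (n + 1) → ℝ) 1, T p x := fun p =>
    setIntegral_sqDistDeriv_div hκ hε i p f g
  have e1 : ∫ x in Set.Icc (0 : Fin (n + 1) → ℝ) 1,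
      (2 * Real.pi * Complex.I * ((weight κ ε x : ℂ) * D x) + κ * ∑ p ∈ {i}ᶜ, S p x) = 0 := by
    rw [← h]
    congr 1
    funext x
    simp only [hS, hD, ← mul_sum, ← sum_mul]
    push_cast
    ring
  rw [integral_add ((hDc.integrableOn_Icc).const_mul _)
    ((integrable_finsetSum _ fun p _ => (hSc p).integrableOn_Icc).const_mul _),
    integral_const_mul, integral_const_mul,
    integral_finsetSum _ fun p _ => (hSc p).integrableOn_Icc] at e1
  simp only [hST, ← mul_sum] at e1
  have e2 : ∫ x in Set.Icc (0 : Fin (n + 1) → ℝ) 1,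
      ((weight κ ε x : ℂ) * D x + κ * ∑ p ∈ {i}ᶜ, T p x) = 0 := by
    rw [integral_add hDc.integrableOn_Icc
      ((integrable_finsetSum _ fun p _ => (hTc p).integrableOn_Icc).const_mul _),
      integral_const_mul, integral_finsetSum _ fun p _ => (hTc p).integrableOn_Icc]
    have hpi : (2 * Real.pi * Complex.I : ℂ) ≠ 0 := Complex.two_pi_I_ne_zero
    apply mul_left_cancel₀ hpi
    linear_combination e1
  rw [← e2]
  congr 1
  funext x
  simp only [hT, ← mul_sum]
  ring

theorem setIntegral_limit_eq_zero {κ : ℝ} (hκ : 0 < κ) (i : Fin N)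
    (f g : MvPolynomial (Fin N) ℝ) :
    ∫ x in Set.Icc (0 : Fin N → ℝ) 1, (weight κ 0 x : ℂ)
      * (hermProd f (X i * pderiv i g) x - hermProd (X i * pderiv i f) g x
        + κ * ∑ p ∈ {i}ᶜ, (1 / 2) * pairForm i p f g x) = 0 := by
  set P : Fin N → (Fin N → ℝ) → ℂ := fun p x => pairForm i p f g x with hP
  set D : (Fin N → ℝ) → ℂ := fun x =>
    hermProd f (X i * pderiv i g) x - hermProd (X i * pderiv i f) g x with hD
  have hPc : ∀ p, Continuous (P p) := fun p => continuous_pairForm i p f g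
  have hDc : Continuous D := (continuous_hermProd _ _).sub (continuous_hermProd _ _)
  have hε : ∀ n : ℕ, (0 : ℝ) < 1 / ((n : ℝ) + 1) := fun n => by positivity
  have hε1 : ∀ n : ℕ, 1 / ((n : ℝ) + 1) ≤ 1 := fun n => by
    rw [div_le_one (by positivity)]
    have : (0 : ℝ) ≤ n := n.cast_nonneg
    linarith
  have hr : ∀ (n : ℕ) p x, ‖((sqDist x i p / (sqDist x i p + 1 / ((n : ℝ) + 1)) : ℝ) : ℂ)‖ ≤ 1 :=
    fun n p x => by
      have hs := sqDist_nonneg x i p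
      have := hε n
      rw [Complex.norm_real, Real.norm_eq_abs, abs_of_nonneg (by positivity)]
      exact div_le_one_of_le₀ (by linarith) (by positivity)
  have hb : ∀ (n : ℕ) x, ‖D x + κ * ∑ p ∈ {i}ᶜ,
      (1 / 2) * (((sqDist x i p / (sqDist x i p + 1 / ((n : ℝ) + 1)) : ℝ) : ℂ) * P p x)‖
      ≤ ‖D x‖ + κ * ∑ p ∈ {i}ᶜ, (1 / 2) * ‖P p x‖ := fun n x => by
    refine (norm_add_le _ _).trans (add_le_add le_rfl ?_)
    rw [norm_mul, Complex.norm_real, Real.norm_eq_abs, abs_of_pos hκ]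
    refine mul_le_mul_of_nonneg_left ((norm_sum_le _ _).trans (sum_le_sum fun p _ => ?_)) hκ.le
    rw [norm_mul, norm_mul]
    refine mul_le_mul (by norm_num) ?_ (by positivity) (by norm_num)
    exact mul_le_of_le_one_left (norm_nonneg _) (hr n p x)
  have hlim := tendsto_integral_of_dominated_convergence
    (μ := volume.restrict (Set.Icc (0 : Fin N → ℝ) 1))
    (F := fun (n : ℕ) x => (weight κ (1 / ((n : ℝ) + 1)) x : ℂ) * (D x + κ * ∑ p ∈ {i}ᶜ,
      (1 / 2) * (((sqDist x i p / (sqDist x i p + 1 / ((n : ℝ) + 1)) : ℝ) : ℂ) * P p x)))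
    (f := fun x => (weight κ 0 x : ℂ) * (D x + κ * ∑ p ∈ {i}ᶜ, (1 / 2) * P p x))
    (fun x => weight κ 1 x * (‖D x‖ + κ * ∑ p ∈ {i}ᶜ, (1 / 2) * ‖P p x‖))
    (fun n => ((continuous_ofReal_weight hκ.le _).mul (hDc.add (continuous_const.mul
      (continuous_finsetSum _ fun p _ => continuous_const.mul
        ((continuous_sqDist_div i p (hε n)).mul (hPc p)))))).aestronglyMeasurable)
    (((continuous_weight hκ.le 1).mul (hDc.norm.add (continuous_const.mul
      (continuous_finsetSum _ fun p _ => continuous_const.mul (hPc p).norm)))).integrableOn_Icc)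
    (fun n => Eventually.of_forall fun x => ?_) (Eventually.of_forall fun x => ?_)
  · have hz : (fun n : ℕ => ∫ x in Set.Icc (0 : Fin N → ℝ) 1,
        (weight κ (1 / ((n : ℝ) + 1)) x : ℂ) * (D x + κ * ∑ p ∈ {i}ᶜ,
        (1 / 2) * (((sqDist x i p / (sqDist x i p + 1 / ((n : ℝ) + 1)) : ℝ) : ℂ) * P p x)))
        = fun _ => 0 := funext fun n => setIntegral_regularized_eq_zero hκ.le (hε n) i f g
    rw [hz] at hlim
    exact tendsto_nhds_unique hlim tendsto_const_nhds
  · rw [norm_mul, Complex.norm_real, Real.norm_eq_abs, abs_of_nonneg (weight_nonneg κ (hε n).le x)]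
    exact mul_le_mul (weight_mono hκ.le (hε n).le (hε1 n) x) (hb n x)
      (norm_nonneg _) (weight_nonneg κ zero_le_one x)
  · have hw : Tendsto (fun n : ℕ => (weight κ (1 / ((n : ℝ) + 1)) x : ℂ)) atTop
        (𝓝 (weight κ 0 x : ℂ)) :=
      (Complex.continuous_ofReal.tendsto _).comp (tendsto_weight hκ.le x)
    -- Where two points collide the ratio does not tend to `1`, but there the limit weight vanishes
    -- and the other factor stays bounded.
    rcases eq_or_ne (weight κ 0 x) 0 with h0 | h0
    · rw [h0] at hw ⊢
      rw [Complex.ofReal_zero, zero_mul]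
      refine squeeze_zero_norm (a := fun n : ℕ => ‖(weight κ (1 / ((n : ℝ) + 1)) x : ℂ)‖ *
        (‖D x‖ + κ * ∑ p ∈ {i}ᶜ, (1 / 2) * ‖P p x‖)) (fun n => ?_) ?_
      · rw [norm_mul]
        exact mul_le_mul_of_nonneg_left (hb n x) (norm_nonneg _)
      · simpa using hw.norm.mul_const (‖D x‖ + κ * ∑ p ∈ {i}ᶜ, (1 / 2) * ‖P p x‖)
    · refine hw.mul (tendsto_const_nhds.add (tendsto_const_nhds.mul
        (tendsto_finsetSum _ fun p hp => tendsto_const_nhds.mul ?_)))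
      -- A zero distance would make the weight zero, because the exponent `κ / 2` is positive.
      have hq : sqDist x i p ≠ 0 := fun hq => h0 (by
        rw [weight, prod_eq_zero (mem_univ i)]
        exact prod_eq_zero hp (by rw [hq, add_zero, Real.zero_rpow (by positivity)]))
      have h1 : Tendsto (fun n : ℕ => sqDist x i p / (sqDist x i p + 1 / ((n : ℝ) + 1))) atTop
          (𝓝 (sqDist x i p / (sqDist x i p + 0))) :=
        tendsto_const_nhds.div (tendsto_const_nhds.add tendsto_one_div_add_atTop_nhds_zero_nat)
          (by simpa using hq)
      rw [add_zero, div_self hq] at h1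
      simpa using ((Complex.continuous_ofReal.tendsto _).comp h1).mul_const (P p x)

/-! ### The inner product on polynomials -/

/-- The inner product `⟨f, g⟩` of two polynomials on the torus. -/
def polyInner (α : ℝ) (f g : MvPolynomial (Fin N) ℝ) : ℂ :=
  ∫ x in Set.Icc (0 : Fin N → ℝ) 1, (weight (1 / α) 0 x : ℂ) * hermProd f g x

theorem torusInner_aeval (α : ℝ) (f g : MvPolynomial (Fin N) ℝ) :
    torusInner α (fun z => MvPolynomial.aeval z f) (fun z => MvPolynomial.aeval z g)
      = polyInner α f g := by
  rw [torusInner, polyInner]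
  congr 1
  funext x
  rw [← prod_norm_rpow_eq_weight, hermProd, conj_torusEval, torusEval, mul_assoc, mul_one_div]

variable {α : ℝ}

theorem continuous_weight_mul_hermProd (hα : 0 < α) (f g : MvPolynomial (Fin N) ℝ) :
    Continuous fun x => (weight (1 / α) 0 x : ℂ) * hermProd f g x :=
  (continuous_ofReal_weight (by positivity) 0).mul (continuous_hermProd f g)

theorem polyInner_add_right (hα : 0 < α) (f g h : MvPolynomial (Fin N) ℝ) :
    polyInner α f (g + h) = polyInner α f g + polyInner α f h := by
  rw [polyInner, polyInner, polyInner,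
    ← integral_add (continuous_weight_mul_hermProd hα f g).integrableOn_Icc
      (continuous_weight_mul_hermProd hα f h).integrableOn_Icc]
  congr 1
  funext x
  simp only [hermProd, torusEval_add]
  ring

theorem polyInner_C_mul_right (c : ℝ) (f g : MvPolynomial (Fin N) ℝ) :
    polyInner α f (C c * g) = c * polyInner α f g := by
  rw [polyInner, polyInner, ← integral_const_mul]
  congr 1
  funext x
  simp only [hermProd, torusEval_mul, torusEval_C]
  ring

theorem conj_polyInner (f g : MvPolynomial (Fin N) ℝ) :
    conj (polyInner α f g) = polyInner α g f := by
  rw [polyInner, polyInner, ← integral_conj]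
  congr 1
  funext x
  simp only [hermProd, map_mul, Complex.conj_ofReal, Complex.conj_conj]
  ring

theorem polyInner_add_left (hα : 0 < α) (f g h : MvPolynomial (Fin N) ℝ) :
    polyInner α (f + g) h = polyInner α f h + polyInner α g h := by
  rw [← conj_polyInner, polyInner_add_right hα, map_add, conj_polyInner, conj_polyInner]

theorem polyInner_C_mul_left (c : ℝ) (f g : MvPolynomial (Fin N) ℝ) :
    polyInner α (C c * f) g = c * polyInner α f g := by
  rw [← conj_polyInner, polyInner_C_mul_right, map_mul, conj_polyInner, Complex.conj_ofReal]

theorem polyInner_rename (τ : Equiv.Perm (Fin N)) (f g : MvPolynomial (Fin N) ℝ) :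
    polyInner α (rename τ f) (rename τ g) = polyInner α f g := by
  rw [polyInner, polyInner]
  conv_rhs => rw [← setIntegral_cube_comp_perm τ]
  congr 1
  funext x
  simp only [hermProd, torusEval_rename, weight_comp_perm]

theorem polyInner_swapVars_left (i p : Fin N) (f g : MvPolynomial (Fin N) ℝ) :
    polyInner α (swapVars i p f) g = polyInner α f (swapVars i p g) := by
  conv_lhs => rw [← swapVars_swapVars i p g]
  exact polyInner_rename _ _ _

theorem polyInner_X_mul (i : Fin N) (f g : MvPolynomial (Fin N) ℝ) :
    polyInner α (X i * f) (X i * g) = polyInner α f g := by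
  rw [polyInner, polyInner]
  congr 1
  funext x
  simp only [hermProd, torusEval_mul, torusEval_X, map_mul]
  linear_combination (weight (1 / α) 0 x : ℂ) * conj (torusEval f x) * torusEval g x
    * torusPoint_mul_conj x i

theorem polyInner_sum_right (hα : 0 < α) {ι : Type*} (s : Finset ι) (f : MvPolynomial (Fin N) ℝ)
    (g : ι → MvPolynomial (Fin N) ℝ) :
    polyInner α f (∑ k ∈ s, g k) = ∑ k ∈ s, polyInner α f (g k) := by
  classical
  induction s using Finset.induction_on with
  | empty => simpa using polyInner_C_mul_right (α := α) 0 f 0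
  | insert a s ha ih => rw [sum_insert ha, sum_insert ha, polyInner_add_right hα, ih]

theorem polyInner_sum_left (hα : 0 < α) {ι : Type*} (s : Finset ι) (f : ι → MvPolynomial (Fin N) ℝ)
    (g : MvPolynomial (Fin N) ℝ) :
    polyInner α (∑ k ∈ s, f k) g = ∑ k ∈ s, polyInner α (f k) g := by
  rw [← conj_polyInner, polyInner_sum_right hα, map_sum]
  exact sum_congr rfl fun k _ => conj_polyInner _ _

theorem polyInner_pairOp_swapVars {i p : Fin N} (h : i ≠ p) (f g : MvPolynomial (Fin N) ℝ) :
    polyInner α (pairOp i p f) (swapVars i p g) = polyInner α (pairOp i p f) g := by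
  rw [← polyInner_swapVars_left, swapVars_pairOp h]

/-- This is the limiting integration by parts with `κ = 1 / α`, multiplied by `α`. The transposition
inside `pairForm` drops out because it is self-adjoint and fixes `pairOp i p f`. -/
theorem polyInner_heckman (hα : 0 < α) (i : Fin N) (f g : MvPolynomial (Fin N) ℝ) :
    polyInner α (heckman α i f) g = polyInner α f (heckman α i g) := by
  have h := setIntegral_limit_eq_zero (κ := 1 / α) (by positivity) i f g
  have key : polyInner α f (X i * pderiv i g) - polyInner α (X i * pderiv i f) g
      + (1 / α : ℝ) * ∑ p ∈ {i}ᶜ, (1 / 2) * (polyInner α f (pairOp i p g)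
        - polyInner α (pairOp i p f) (swapVars i p g)) = 0 := by
    rw [← h]
    have hc := continuous_weight_mul_hermProd (N := N) hα
    have hp : ∀ p, Continuous fun x : Fin N → ℝ =>
        (1 / 2 : ℂ) * ((weight (1 / α) 0 x : ℂ) * pairForm i p f g x) := fun p =>
      continuous_const.mul ((continuous_ofReal_weight (by positivity) 0).mul
        (continuous_pairForm i p f g))
    have hD : Continuous fun x => (weight (1 / α) 0 x : ℂ) * hermProd f (X i * pderiv i g) x
        - (weight (1 / α) 0 x : ℂ) * hermProd (X i * pderiv i f) g x := (hc _ _).sub (hc _ _)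
    have hS : Continuous fun x : Fin N → ℝ => ((1 / α : ℝ) : ℂ) * ∑ p ∈ {i}ᶜ,
        (1 / 2 : ℂ) * ((weight (1 / α) 0 x : ℂ) * pairForm i p f g x) :=
      continuous_const.mul (continuous_finsetSum _ fun p _ => hp p)
    have hpair : ∀ p, (1 / 2 : ℂ) * (polyInner α f (pairOp i p g)
        - polyInner α (pairOp i p f) (swapVars i p g)) = ∫ x in Set.Icc (0 : Fin N → ℝ) 1,
          (1 / 2 : ℂ) * ((weight (1 / α) 0 x : ℂ) * pairForm i p f g x) := fun p => by
      rw [polyInner, polyInner, ← integral_sub (hc _ _).integrableOn_Icc (hc _ _).integrableOn_Icc,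
        ← integral_const_mul]
      simp only [pairForm, mul_sub]
    simp only [hpair]
    rw [← integral_finsetSum _ fun p _ => (hp p).integrableOn_Icc, ← integral_const_mul, polyInner,
      polyInner, ← integral_sub (hc _ _).integrableOn_Icc (hc _ _).integrableOn_Icc,
      ← integral_add hD.integrableOn_Icc hS.integrableOn_Icc]
    congr 1
    funext x
    simp only [← mul_sum]
    ring
  have hs : ∑ p ∈ {i}ᶜ, (1 / 2 : ℂ) * (polyInner α f (pairOp i p g)
        - polyInner α (pairOp i p f) (swapVars i p g))
      = ∑ p ∈ {i}ᶜ, (1 / 2 : ℂ) * polyInner α f (pairOp i p g)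
        - ∑ p ∈ {i}ᶜ, (1 / 2 : ℂ) * polyInner α (pairOp i p f) g := by
    rw [← sum_sub_distrib]
    refine sum_congr rfl fun p hp => ?_
    rw [polyInner_pairOp_swapVars (by simpa [eq_comm] using hp)]
    ring
  have hH : ∀ f : MvPolynomial (Fin N) ℝ, heckman α i f
      = C α * (X i * pderiv i f) + C (1 / 2) * ∑ p ∈ {i}ᶜ, pairOp i p f := fun f => by
    rw [heckman, mul_assoc]; rfl
  rw [hs] at key
  have hαα : (α : ℂ) * ((1 / α : ℝ) : ℂ) = 1 := by
    rw [← Complex.ofReal_mul, mul_one_div_cancel hα.ne', Complex.ofReal_one]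
  have hhalf : ((1 / 2 : ℝ) : ℂ) = 1 / 2 := by norm_num
  rw [hH, hH, polyInner_add_left hα, polyInner_add_right hα, polyInner_C_mul_left,
    polyInner_C_mul_left, polyInner_C_mul_right, polyInner_C_mul_right, polyInner_sum_left hα,
    polyInner_sum_right hα, mul_sum, mul_sum, hhalf]
  linear_combination (-(α : ℂ)) * key + (∑ p ∈ {i}ᶜ, (1 / 2 : ℂ) * polyInner α f (pairOp i p g)
    - ∑ p ∈ {i}ᶜ, (1 / 2 : ℂ) * polyInner α (pairOp i p f) g) * hαα

theorem polyInner_cherednik (hα : 0 < α) (i : Fin N) (f g : MvPolynomial (Fin N) ℝ) :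
    polyInner α (cherednik α i f) g = polyInner α f (cherednik α i g) := by
  have hH : ∀ f : MvPolynomial (Fin N) ℝ, cherednik α i f = heckman α i f
      + C (-(1 / 2)) * ∑ p ∈ {i}ᶜ, C (indexSign i p) * swapVars i p f
      + C (-((N - 1 : ℝ) / 2)) * f := fun f => by
    rw [cherednik_eq_signedOp, signedOp, map_neg, map_neg]; ring
  simp only [hH, polyInner_add_left hα, polyInner_add_right hα, polyInner_C_mul_left,
    polyInner_C_mul_right, polyInner_sum_left hα, polyInner_sum_right hα, polyInner_heckman hα,
    polyInner_swapVars_left]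

/-! ### Positivity -/

theorem infinite_image_exp :
    ((fun t : ℝ => Complex.exp (2 * Real.pi * Complex.I * (t : ℂ))) '' Set.Ioo 0 1).Infinite := by
  refine (Set.Ioo_infinite zero_lt_one).image fun s hs t ht h => ?_
  obtain ⟨n, hn⟩ := Complex.exp_eq_exp_iff_exists_int.mp h
  have h2 : (s : ℂ) = t + n := by
    apply mul_left_cancel₀ Complex.two_pi_I_ne_zero
    linear_combination hn
  have h3 : s = t + n := by exact_mod_cast h2
  have h4 : (n : ℝ) < 1 := by linarith [hs.2, ht.1]
  have h5 : (-1 : ℝ) < n := by linarith [hs.1, ht.2]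
  have h6 : n = 0 := by
    have h4' : n < 1 := by exact_mod_cast h4
    have h5' : -1 < n := by exact_mod_cast h5
    omega
  simpa [h6] using h3

theorem exists_torusEval_ne_zero {f : MvPolynomial (Fin N) ℝ} (hf : f ≠ 0) :
    ∃ x ∈ Set.pi Set.univ fun _ : Fin N => Set.Ioo (0 : ℝ) 1, torusEval f x ≠ 0 := by
  by_contra! h
  have hmap : MvPolynomial.map (algebraMap ℝ ℂ) f = 0 := by
    refine MvPolynomial.funext_set (fun _ : Fin N => _) (fun _ => infinite_image_exp)
      fun z hz => ?_
    simp only [Set.mem_pi, Set.mem_univ, true_imp_iff, Set.mem_image] at hz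
    choose x hx hxz using hz
    have hz' : z = torusPoint x := funext fun i => (hxz i).symm
    rw [map_zero, MvPolynomial.eval_map, hz']
    exact h x fun i _ => hx i
  exact hf ((MvPolynomial.map_injective _ (algebraMap ℝ ℂ).injective)
    (hmap.trans (map_zero _).symm))

theorem polyInner_self_pos (hα : 0 < α) {f : MvPolynomial (Fin N) ℝ} (hf : f ≠ 0) :
    ∃ r : ℝ, 0 < r ∧ polyInner α f f = r := by
  set F : (Fin N → ℝ) → ℝ := fun x => weight (1 / α) 0 x * ‖torusEval f x‖ ^ 2 with hF
  have hFc : Continuous F := (continuous_weight (by positivity) 0).mul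
    ((continuous_torusEval f).norm.pow 2)
  have hF0 : ∀ x, 0 ≤ F x := fun x => mul_nonneg (weight_nonneg _ le_rfl x) (by positivity)
  refine ⟨∫ x in Set.Icc (0 : Fin N → ℝ) 1, F x, ?_, ?_⟩
  · rw [setIntegral_pos_iff_support_of_nonneg_ae (Eventually.of_forall hF0) hFc.integrableOn_Icc]
    -- Multiplying `f` by this product forces the point found below to have distinct coordinates on
    -- the torus, so the weight is nonzero there too.
    have hV : (∏ j : Fin N, ∏ k ∈ {j}ᶜ, (X j - X k) : MvPolynomial (Fin N) ℝ) ≠ 0 :=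
      prod_ne_zero_iff.mpr fun j _ => prod_ne_zero_iff.mpr fun k hk =>
        X_sub_X_ne_zero (by simpa [eq_comm] using hk)
    obtain ⟨x, hx, hne⟩ := exists_torusEval_ne_zero (mul_ne_zero hf hV)
    rw [torusEval_mul] at hne
    have hfx := left_ne_zero_of_mul hne
    have hVx := right_ne_zero_of_mul hne
    have hFx : F x ≠ 0 := by
      refine mul_ne_zero ?_ (by simpa using hfx)
      refine prod_ne_zero_iff.mpr fun j _ => prod_ne_zero_iff.mpr fun k hk => ?_
      have hjk : torusPoint x j - torusPoint x k ≠ 0 := by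
        rw [torusEval, map_prod] at hVx
        have h1 := prod_ne_zero_iff.mp hVx j (mem_univ j)
        rw [map_prod] at h1
        have h2 := prod_ne_zero_iff.mp h1 k hk
        simpa using h2
      have hpos : 0 < sqDist x j k := by
        rw [← normSq_torusPoint_sub]
        exact pow_pos (norm_pos_iff.mpr hjk) 2
      rw [add_zero]
      exact (Real.rpow_pos_of_pos hpos _).ne'
    have hopen : IsOpen (Function.support F ∩ Set.pi Set.univ fun _ : Fin N => Set.Ioo (0 : ℝ) 1) :=
      hFc.isOpen_support.inter (isOpen_set_pi Set.finite_univ fun _ _ => isOpen_Ioo)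
    refine lt_of_lt_of_le (hopen.measure_pos volume ⟨x, hFx, hx⟩) (measure_mono ?_)
    refine Set.inter_subset_inter_right _ fun y hy => ?_
    exact ⟨fun i => (hy i trivial).1.le, fun i => (hy i trivial).2.le⟩
  · rw [polyInner, ← integral_complex_ofReal]
    congr 1
    funext x
    rw [hermProd, Complex.conj_mul', hF]
    push_cast
    rfl

theorem polyInner_self_ne_zero (hα : 0 < α) {f : MvPolynomial (Fin N) ℝ} (hf : f ≠ 0) :
    polyInner α f f ≠ 0 := by
  obtain ⟨r, hr, h⟩ := polyInner_self_pos hα hf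
  rw [h]
  exact_mod_cast hr.ne'

/-! ### Joint eigenfunctions -/

/-- The colength is thus the rank of `i` when larger parts come first and ties go to the smaller
index. -/
theorem coleg_eq_card (η : Fin N → ℕ) (i : Fin N) :
    coleg η i = #{k | η i < η k ∨ (η i = η k ∧ k < i)} := by
  rw [coleg, ← card_union_of_disjoint]
  · congr 1
    ext k
    simp only [mem_union, mem_filter, mem_univ, true_and]
    rcases lt_trichotomy k i with h | rfl | h
    · simp only [h, h.not_gt, true_and, and_true, false_and, false_or, le_iff_lt_or_eq]
    · simp
    · simp only [h, h.not_gt, true_and, and_false, false_and, or_false]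
  · rw [disjoint_left]
    intro k h1 h2
    simp only [mem_filter, mem_univ, true_and] at h1 h2
    exact h1.1.not_gt h2.1

/-- Going up in this ranking, `α η_i` weakly increases and the colength strictly decreases; the
ranking is total, so the converse follows. -/
theorem eigval_lt_eigval_iff (hα : 0 < α) (η : Fin N → ℕ) (i k : Fin N) :
    eigval α η i < eigval α η k ↔ η i < η k ∨ (η i = η k ∧ k < i) := by
  have key : ∀ i k : Fin N, (η i < η k ∨ (η i = η k ∧ k < i)) → eigval α η i < eigval α η k := by
    intro i k h
    have hc : coleg η k < coleg η i := by
      rw [coleg_eq_card, coleg_eq_card]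
      refine card_lt_card ⟨fun m hm => ?_, fun hsub => ?_⟩
      · simp only [mem_filter, mem_univ, true_and] at hm ⊢
        rcases hm with h1 | ⟨h1, h1'⟩ <;> rcases h with h2 | ⟨h2, h2'⟩
        · exact Or.inl (h2.trans h1)
        · exact Or.inl (h2 ▸ h1)
        · exact Or.inl (h1 ▸ h2)
        · exact Or.inr ⟨h2.trans h1, h1'.trans h2'⟩
      · have := hsub (x := k) (by simpa using h)
        simp at this
    have hle : η i ≤ η k := by rcases h with h | h <;> omega
    have h1 : α * (η i : ℝ) ≤ α * η k := mul_le_mul_of_nonneg_left (by exact_mod_cast hle) hα.le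
    have h2 : (coleg η k : ℝ) < coleg η i := by exact_mod_cast hc
    rw [eigval, eigval]
    linarith
  refine ⟨fun h => ?_, key i k⟩
  by_contra hcon
  rcases eq_or_ne i k with rfl | hik
  · exact lt_irrefl _ h
  · have h3 : η k < η i ∨ (η k = η i ∧ i < k) := by
      rcases lt_or_gt_of_ne hik with h4 | h4 <;> simp only [h4, h4.not_gt, and_true, and_false, or_false] at hcon ⊢ <;> omega
    exact (key k i h3).not_gt h

theorem eigval_injective (hα : 0 < α) {η ν : Fin N → ℕ} (h : ∀ i, eigval α η i = eigval α ν i) :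
    η = ν := by
  funext i
  have hc : coleg η i = coleg ν i := by
    rw [coleg_eq_card, coleg_eq_card]
    congr 1
    ext k
    simp only [mem_filter, mem_univ, true_and, ← eigval_lt_eigval_iff hα, h]
  have hi := h i
  rw [eigval, eigval, hc, sub_left_inj] at hi
  exact_mod_cast mul_left_cancel₀ hα.ne' hi

theorem exists_maximal {f : MvPolynomial (Fin N) ℝ} (hf : f ≠ 0) :
    ∃ μ : Fin N → ℕ, f.coeff (expo μ) ≠ 0 ∧ ∀ ν, CompLT μ ν → f.coeff (expo ν) = 0 := by
  let r : (Fin N → ℕ) → (Fin N → ℕ) → Prop := fun a b => CompLT b a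
  have : IsTrans (Fin N → ℕ) r := ⟨fun a b c h h' => h'.trans h⟩
  have : Std.Irrefl r := ⟨CompLT.irrefl⟩
  have : IsStrictOrder (Fin N → ℕ) r := {}
  have hfin : Set.Finite {μ : Fin N → ℕ | f.coeff (expo μ) ≠ 0} := by
    refine (f.support.finite_toSet.preimage
      (Finsupp.equivFunOnFinite.symm.injective.injOn)).subset fun μ hμ => ?_
    simpa using hμ
  obtain ⟨m, hm⟩ := MvPolynomial.ne_zero_iff.mp hf
  obtain ⟨μ, hμ, hmax⟩ := (hfin.wellFoundedOn (r := r)).has_min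
    {μ | f.coeff (expo μ.1) ≠ 0} ⟨⟨Finsupp.equivFunOnFinite m, by simpa [expo] using hm⟩, by
      simpa [expo] using hm⟩
  refine ⟨μ.1, hμ, fun ν hν => ?_⟩
  by_contra hcon
  exact hmax ⟨ν, hcon⟩ hcon hν

/-- A maximal exponent of a nonzero `f` would have the eigenvalues of `η`, hence equal `η`, where
the coefficient is zero. -/
theorem eq_zero_of_eigen (hα : 0 < α) {η : Fin N → ℕ} {f : MvPolynomial (Fin N) ℝ}
    (hf : ∀ i, cherednik α i f = C (eigval α η i) * f) (h0 : f.coeff (expo η) = 0) : f = 0 := by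
  by_contra hne
  obtain ⟨μ, hμ, hmax⟩ := exists_maximal hne
  have h : η = μ := eigval_injective hα fun i => by
    have h1 := coeff_cherednik_of_maximal α i hmax
    rw [hf, MvPolynomial.coeff_C_mul] at h1
    exact mul_right_cancel₀ hμ h1
  exact hμ (h ▸ h0)

theorem eq_of_eigen (hα : 0 < α) {η : Fin N → ℕ} {f g : MvPolynomial (Fin N) ℝ}
    (hf : ∀ i, cherednik α i f = C (eigval α η i) * f)
    (hg : ∀ i, cherednik α i g = C (eigval α η i) * g)
    (h : f.coeff (expo η) = g.coeff (expo η)) : f = g := by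
  refine sub_eq_zero.mp (eq_zero_of_eigen hα (η := η) (fun i => ?_) ?_)
  · have h1 : f - g = f + C (-1) * g := by rw [map_neg, map_one]; ring
    rw [h1, cherednik_add, cherednik_C_mul, hf, hg]
    ring
  · rw [MvPolynomial.coeff_sub, h, sub_self]

theorem IsNonsymJack.eigen_eigval {η : Fin N → ℕ} {E : MvPolynomial (Fin N) ℝ}
    (hE : IsNonsymJack α η E) (i : Fin N) : cherednik α i E = C (eigval α η i) * E := by
  obtain ⟨c, hc⟩ := hE.eigen i
  have h := coeff_cherednik_of_maximal α i (f := E) (μ := η) fun ν hν =>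
    hE.coeff_eq_zero ν (fun h => CompLT.irrefl ν (by rwa [← h] at hν)) fun h' =>
      CompLT.irrefl η (hν.trans h')
  rw [hc, MvPolynomial.coeff_C_mul] at h
  change c * E.coeff (expo η) = _ at h
  rw [show E.coeff (expo η) = 1 from hE.coeff_self, mul_one, mul_one] at h
  rw [hc, h]

/-! ### Existence and uniqueness -/

theorem finite_setOf_compLT (η : Fin N → ℕ) : {ν | CompLT ν η}.Finite := by
  refine (Set.finite_Iic fun _ : Fin N => ∑ i, η i).subset fun ν hν i => ?_
  rw [← hν.1]
  exact single_le_sum (f := ν) (fun _ _ => Nat.zero_le _) (mem_univ i)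

instance finiteDimensional_lower (η : Fin N → ℕ) : FiniteDimensional ℝ (lower η) := by
  have hle : lower η ≤ Submodule.span ℝ (mono '' {ν | CompLT ν η}) := fun f hf => by
    rw [exists_sum_mono f]
    refine Submodule.sum_mem _ fun m hm => ?_
    rw [← MvPolynomial.smul_eq_C_mul]
    refine Submodule.smul_mem _ _ (Submodule.subset_span ⟨_, ?_, rfl⟩)
    by_contra hcon
    exact MvPolynomial.mem_support_iff.mp hm (by simpa [expo] using hf _ hcon)
  have := FiniteDimensional.span_of_finite ℝ ((finite_setOf_compLT η).image (mono (N := N)))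
  exact Submodule.finiteDimensional_of_le hle

/-- The real part of the inner product of two polynomials, as a bilinear form. -/
def reInner (hα : 0 < α) : LinearMap.BilinForm ℝ (MvPolynomial (Fin N) ℝ) :=
  LinearMap.mk₂ ℝ (fun f g => (polyInner α f g).re)
    (fun f g h => by rw [polyInner_add_left hα, Complex.add_re])
    (fun c f g => by
      rw [MvPolynomial.smul_eq_C_mul, polyInner_C_mul_left, Complex.re_ofReal_mul, smul_eq_mul])
    (fun f g h => by rw [polyInner_add_right hα, Complex.add_re])
    (fun c f g => by
      rw [MvPolynomial.smul_eq_C_mul, polyInner_C_mul_right, Complex.re_ofReal_mul, smul_eq_mul])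

theorem reInner_apply (hα : 0 < α) (f g : MvPolynomial (Fin N) ℝ) :
    reInner hα f g = (polyInner α f g).re := rfl

theorem eq_zero_of_reInner_self (hα : 0 < α) {f : MvPolynomial (Fin N) ℝ}
    (h : reInner hα f f = 0) : f = 0 := by
  by_contra hne
  obtain ⟨r, hr, h'⟩ := polyInner_self_pos hα hne
  rw [reInner_apply, h', Complex.ofReal_re] at h
  exact hr.ne' h

/-- A positive definite form is nondegenerate on `V`, so every functional on `V` is represented by a
vector of `V`. -/
theorem exists_orthogonal_projection (hα : 0 < α)
    (V : Submodule ℝ (MvPolynomial (Fin N) ℝ)) [FiniteDimensional ℝ V]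
    (f : MvPolynomial (Fin N) ℝ) : ∃ v ∈ V, ∀ w ∈ V, reInner hα (f - v) w = 0 := by
  let φ : V →ₗ[ℝ] Module.Dual ℝ V := ((reInner hα).domRestrict₁₂ V V)
  have hinj : Function.Injective φ := by
    rw [← LinearMap.ker_eq_bot, LinearMap.ker_eq_bot']
    intro v hv
    have := LinearMap.congr_fun hv v
    exact Subtype.ext (eq_zero_of_reInner_self hα this)
  have hsurj : Function.Surjective φ :=
    (LinearMap.injective_iff_surjective_of_finrank_eq_finrank
      (Subspace.dual_finrank_eq).symm).mp hinj
  obtain ⟨v, hv⟩ := hsurj ((reInner hα f).domRestrict V)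
  refine ⟨v, v.2, fun w hw => ?_⟩
  have h := LinearMap.congr_fun hv ⟨w, hw⟩
  have h1 : reInner hα v w = reInner hα f w := h
  rw [map_sub, LinearMap.sub_apply, h1, sub_self]

theorem exists_isNonsymJack (hα : 0 < α) (η : Fin N → ℕ) : ∃ E, IsNonsymJack α η E := by
  obtain ⟨v, hv, horth⟩ := exists_orthogonal_projection hα (lower η) (mono η)
  refine ⟨mono η - v, ?_, fun ν hν hlt => ?_, fun i => ⟨eigval α η i, ?_⟩⟩
  · rw [MvPolynomial.coeff_sub, coeff_mono, if_pos rfl, hv η (CompLT.irrefl η), sub_zero]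
  · rw [MvPolynomial.coeff_sub, coeff_mono, if_neg (Ne.symm hν), hv ν hlt, sub_zero]
  · set E := mono η - v with hE
    have hmem : cherednik α i E - C (eigval α η i) * E ∈ lower η := by
      have h1 := cherednik_mono_sub_mem_lower α i η
      have h2 := cherednik_mem_lower (α := α) i hv
      have h3 := Submodule.smul_mem _ (eigval α η i) hv
      rw [MvPolynomial.smul_eq_C_mul] at h3
      have h4 : cherednik α i E = cherednik α i (mono η) - cherednik α i v :=
        map_sub (cherednikLin α i) _ _
      convert sub_mem h1 (sub_mem h2 h3) using 1
      rw [h4, hE]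
      ring
    refine sub_eq_zero.mp (eq_zero_of_reInner_self hα ?_)
    set w := cherednik α i E - C (eigval α η i) * E with hw
    -- Self-adjointness moves `ξ_i` onto `w`, and `ξ_i w` is again in the lower span, to which `E`
    -- is orthogonal.
    have h5 : reInner hα (cherednik α i E) w = 0 := by
      rw [reInner_apply, polyInner_cherednik hα, ← reInner_apply hα]
      exact horth _ (cherednik_mem_lower i hmem)
    have h6 : reInner hα (C (eigval α η i) * E) w = 0 := by
      rw [← MvPolynomial.smul_eq_C_mul, map_smul, LinearMap.smul_apply, horth _ hmem, smul_zero]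
    have h7 : reInner hα w w
        = reInner hα (cherednik α i E) w - reInner hα (C (eigval α η i) * E) w := by
      rw [← LinearMap.sub_apply, ← map_sub]
    rw [h7, h5, h6, sub_zero]

theorem existsUnique_isNonsymJack (hα : 0 < α) (η : Fin N → ℕ) : ∃! E, IsNonsymJack α η E := by
  obtain ⟨E, hE⟩ := exists_isNonsymJack hα η
  exact ⟨E, hE, fun F hF => eq_of_eigen hα hF.eigen_eigval hE.eigen_eigval
    (hF.coeff_self.trans hE.coeff_self.symm)⟩

theorem isNonsymJack_jackE (hα : 0 < α) (η : Fin N → ℕ) : IsNonsymJack α η (jackE α η) :=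
  Classical.epsilon_spec (exists_isNonsymJack hα η)

theorem jackE_ne_zero (hα : 0 < α) (η : Fin N → ℕ) : jackE α η ≠ 0 := fun h => by
  have := (isNonsymJack_jackE hα η).coeff_self
  rw [h] at this
  simp at this

theorem jackNorm_eq (α : ℝ) (η : Fin N → ℕ) :
    jackNorm α η = polyInner α (jackE α η) (jackE α η) := torusInner_aeval _ _ _

/-! ### Raising a composition -/

/-- The composition `(η_2, …, η_N, η_1 + 1)`. -/
def raiseComp {n : ℕ} (η : Fin (n + 1) → ℕ) : Fin (n + 1) → ℕ :=
  Fin.snoc (α := fun _ => ℕ) (fun j => η j.succ) (η 0 + 1)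

@[simp]
theorem raiseComp_castSucc {n : ℕ} (η : Fin (n + 1) → ℕ) (j : Fin n) :
    raiseComp η j.castSucc = η j.succ := by simp [raiseComp]

@[simp]
theorem raiseComp_last {n : ℕ} (η : Fin (n + 1) → ℕ) :
    raiseComp η (Fin.last n) = η 0 + 1 := by simp [raiseComp]

/-- Moving the first part to the end costs it priority in ties; adding `1` to it restores exactly
that priority. -/
theorem coleg_raiseComp_castSucc {n : ℕ} (η : Fin (n + 1) → ℕ) (j : Fin n) :
    coleg (raiseComp η) j.castSucc = coleg η j.succ := by
  rw [coleg_eq_card, coleg_eq_card, card_filter, card_filter, Fin.sum_univ_castSucc,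
    Fin.sum_univ_succ, add_comm]
  simp only [raiseComp_castSucc, raiseComp_last, Fin.castSucc_lt_castSucc_iff,
    Fin.succ_lt_succ_iff, (Fin.castSucc_lt_last j).not_gt, Fin.succ_pos, and_true, and_false,
    or_false]
  congr 1
  split_ifs <;> omega

theorem coleg_raiseComp_last {n : ℕ} (η : Fin (n + 1) → ℕ) :
    coleg (raiseComp η) (Fin.last n) = coleg η 0 := by
  rw [coleg_eq_card, coleg_eq_card, card_filter, card_filter, Fin.sum_univ_castSucc,
    Fin.sum_univ_succ, add_comm]
  simp only [raiseComp_castSucc, raiseComp_last, Fin.castSucc_lt_last, lt_irrefl, and_true,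
    and_false, or_false, if_false, Fin.not_lt_zero]
  congr 1
  refine sum_congr rfl fun k _ => ?_
  split_ifs <;> omega

theorem coeff_raise {n : ℕ} (η : Fin (n + 1) → ℕ) (f : MvPolynomial (Fin (n + 1)) ℝ) :
    (raise f).coeff (expo (raiseComp η)) = f.coeff (expo η) := by
  have h : expo (raiseComp η) = Finsupp.single (Fin.last n) 1
      + Finsupp.mapDomain (finRotate (n + 1)).symm (expo η) := by
    ext k
    have h2 := fun j => Finsupp.mapDomain_apply (finRotate (n + 1)).symm.injective (expo η) j
    refine Fin.lastCases ?_ (fun j => ?_) k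
    · have := h2 0
      rw [finRotate_symm_zero] at this
      rw [Finsupp.add_apply, this]
      simp [add_comm]
    · have := h2 j.succ
      rw [finRotate_symm_succ] at this
      rw [Finsupp.add_apply, this]
      simp [(Fin.castSucc_lt_last j).ne]
  rw [h, raise, MvPolynomial.coeff_X_mul,
    MvPolynomial.coeff_rename_mapDomain _ (finRotate (n + 1)).symm.injective]

/-- By `eq_of_eigen` only the eigenvalues and one coefficient need comparison; triangularity of the
raised polynomial need not be checked. -/
theorem jackE_raiseComp (hα : 0 < α) {n : ℕ} (η : Fin (n + 1) → ℕ) :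
    jackE α (raiseComp η) = raise (jackE α η) := by
  have hE := isNonsymJack_jackE hα η
  have hF := isNonsymJack_jackE hα (raiseComp η)
  refine eq_of_eigen hα hF.eigen_eigval (fun i => ?_) ?_
  · refine Fin.lastCases ?_ (fun j => ?_) i
    · rw [cherednik_last_raise, hE.eigen_eigval, ← add_mul, ← map_add]
      have : eigval α (raiseComp η) (Fin.last n) = eigval α η 0 + α := by
        rw [eigval, eigval, coleg_raiseComp_last, raiseComp_last]
        push_cast
        ring
      rw [this, raise, raise, map_mul, MvPolynomial.rename_C, mul_left_comm]
    · rw [cherednik_castSucc_raise, hE.eigen_eigval]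
      have : eigval α (raiseComp η) j.castSucc = eigval α η j.succ := by
        rw [eigval, eigval, coleg_raiseComp_castSucc, raiseComp_castSucc]
      rw [this, raise, raise, map_mul, MvPolynomial.rename_C, mul_left_comm]
  · rw [coeff_raise]
    exact hF.coeff_self.trans hE.coeff_self.symm

theorem jackNorm_raiseComp (hα : 0 < α) {n : ℕ} (η : Fin (n + 1) → ℕ) :
    jackNorm α (raiseComp η) = jackNorm α η := by
  rw [jackNorm_eq, jackNorm_eq, jackE_raiseComp hα, raise, polyInner_X_mul, polyInner_rename]

/-! ### Interchanging two adjacent parts -/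

theorem coleg_comp_swap {η : Fin N → ℕ} {i k : Fin N} (hk : (k : ℕ) = i + 1) (h : η k < η i)
    (j : Fin N) : coleg (η ∘ Equiv.swap i k) (Equiv.swap i k j) = coleg η j := by
  rw [coleg_eq_card, coleg_eq_card, card_filter, card_filter, ← Equiv.sum_comp (Equiv.swap i k)]
  refine sum_congr rfl fun m _ => ?_
  simp only [Function.comp, Equiv.swap_apply_self]
  congr 1
  rw [eq_iff_iff]
  refine or_congr_right (and_congr_right fun he => ?_)
  simp only [Equiv.swap_apply_def, Fin.lt_def]
  split_ifs <;> simp_all only [Fin.ext_iff] <;> omega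

theorem eigval_comp_swap {η : Fin N → ℕ} {i k : Fin N} (hk : (k : ℕ) = i + 1) (h : η k < η i)
    (j : Fin N) : eigval α (η ∘ Equiv.swap i k) (Equiv.swap i k j) = eigval α η j := by
  rw [eigval, eigval, coleg_comp_swap hk h]
  simp

theorem coeff_swapVars (i k : Fin N) (η : Fin N → ℕ) (f : MvPolynomial (Fin N) ℝ) :
    (swapVars i k f).coeff (expo η) = f.coeff (expo (η ∘ Equiv.swap i k)) := by
  have h : expo η = Finsupp.mapDomain (Equiv.swap i k) (expo (η ∘ Equiv.swap i k)) := by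
    ext m
    have := Finsupp.mapDomain_apply (Equiv.swap i k).injective (expo (η ∘ Equiv.swap i k))
      (Equiv.swap i k m)
    rw [Equiv.swap_apply_self] at this
    rw [this]
    simp
  rw [h, swapVars, MvPolynomial.coeff_rename_mapDomain _ (Equiv.swap i k).injective]

/-- The scalar is the one for which the inhomogeneous terms `±f` of the Hecke relations cancel. The
second summand does not affect the coefficient at `η`, since the interchanged composition is lower.
-/
theorem jackE_eq_swap (hα : 0 < α) {η : Fin N → ℕ} {i k : Fin N} (hk : (k : ℕ) = i + 1)
    (h : η k < η i) :
    jackE α η = swapVars i k (jackE α (η ∘ Equiv.swap i k))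
      + C (1 / (eigval α η i - eigval α η k)) * jackE α (η ∘ Equiv.swap i k) := by
  have hik : i ≠ k := fun h' => by rw [h'] at hk; omega
  have hE := isNonsymJack_jackE hα (η ∘ Equiv.swap i k)
  have hF := isNonsymJack_jackE hα η
  set E := jackE α (η ∘ Equiv.swap i k) with hEdef
  set c := 1 / (eigval α η i - eigval α η k) with hc
  have hpos : eigval α η k < eigval α η i :=
    (eigval_lt_eigval_iff hα η k i).mpr (Or.inl h)
  have hcmul : c * (eigval α η i - eigval α η k) = 1 := by
    rw [hc, one_div_mul_cancel (sub_pos.mpr hpos).ne']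
  have hCmul : (C c * (C (eigval α η i) - C (eigval α η k)) : MvPolynomial (Fin N) ℝ) = 1 := by
    rw [← map_sub, ← map_mul, hcmul, map_one]
  have hi : cherednik α i E = C (eigval α η k) * E := by
    have := eigval_comp_swap (α := α) hk h k
    rw [Equiv.swap_apply_right] at this
    rw [hE.eigen_eigval, this]
  have hkE : cherednik α k E = C (eigval α η i) * E := by
    have := eigval_comp_swap (α := α) hk h i
    rw [Equiv.swap_apply_left] at this
    rw [hE.eigen_eigval, this]
  refine eq_of_eigen hα hF.eigen_eigval (fun j => ?_) ?_
  · rw [cherednik_add, cherednik_C_mul]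
    rcases eq_or_ne j i with rfl | hji
    · rw [cherednik_swapVars_left α hk, hkE, hi, swapVars_C_mul]
      linear_combination (-E) * hCmul
    rcases eq_or_ne j k with rfl | hjk
    · rw [cherednik_swapVars_right α hk, hkE, hi, swapVars_C_mul]
      linear_combination E * hCmul
    · have := eigval_comp_swap (α := α) hk h j
      rw [Equiv.swap_apply_of_ne_of_ne hji hjk] at this
      rw [cherednik_swapVars_of_ne α hk hji hjk, hE.eigen_eigval, this, swapVars_C_mul]
      ring
  · have hlt : CompLT (η ∘ Equiv.swap i k) η := compLT_swap (by rw [Fin.lt_def]; omega) h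
    have h0 : E.coeff (expo η) = 0 := hE.coeff_eq_zero η
      (fun he => CompLT.irrefl η (by rwa [← he] at hlt)) fun hcon =>
      CompLT.irrefl η (hcon.trans hlt)
    rw [MvPolynomial.coeff_add, MvPolynomial.coeff_C_mul, coeff_swapVars, h0, mul_zero, add_zero]
    exact hF.coeff_self.trans hE.coeff_self.symm

theorem polyInner_eq_zero_of_eigen (hα : 0 < α) (i : Fin N) {f g : MvPolynomial (Fin N) ℝ}
    {a b : ℝ} (hab : a ≠ b) (hf : cherednik α i f = C a * f) (hg : cherednik α i g = C b * g) :
    polyInner α f g = 0 := by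
  have h := polyInner_cherednik hα i f g
  rw [hf, hg, polyInner_C_mul_left, polyInner_C_mul_right] at h
  have hab' : (a : ℂ) - b ≠ 0 := sub_ne_zero.mpr (by exact_mod_cast hab)
  exact (mul_eq_zero.mp (by linear_combination h : ((a : ℂ) - b) * polyInner α f g = 0)).resolve_left
    hab'

/-- Write `F = sE + cE`. The eigenvalues of `ξ_i` on `F` and `E` differ, so `⟨F, E⟩ = 0` and `⟨sE,
E⟩ = -c⟨E, E⟩`. Hence `⟨F, F⟩ = ⟨F, sE⟩ = (1 - c²)⟨E, E⟩`. -/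
theorem jackNorm_comp_swap (hα : 0 < α) {η : Fin N → ℕ} {i k : Fin N} (hk : (k : ℕ) = i + 1)
    (h : η k < η i) :
    jackNorm α η = jackNorm α (η ∘ Equiv.swap i k)
      * ((1 - (1 / (eigval α η i - eigval α η k)) ^ 2 : ℝ) : ℂ) := by
  have hE := isNonsymJack_jackE hα (η ∘ Equiv.swap i k)
  have hF := isNonsymJack_jackE hα η
  have hEF := jackE_eq_swap hα hk h
  rw [jackNorm_eq, jackNorm_eq]
  set E := jackE α (η ∘ Equiv.swap i k) with hEdef
  set F := jackE α η with hFdef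
  set c := 1 / (eigval α η i - eigval α η k) with hc
  have hpos : eigval α η k < eigval α η i :=
    (eigval_lt_eigval_iff hα η k i).mpr (Or.inl h)
  have horth : polyInner α F E = 0 := by
    have h1 := hE.eigen_eigval i
    have := eigval_comp_swap (α := α) hk h k
    rw [Equiv.swap_apply_right] at this
    rw [this] at h1
    exact polyInner_eq_zero_of_eigen hα i hpos.ne' (hF.eigen_eigval i) h1
  have h2 : polyInner α (swapVars i k E) E = -c * polyInner α E E := by
    rw [hEF, polyInner_add_left hα, polyInner_C_mul_left] at horth
    linear_combination horth
  have h3 : polyInner α F F = polyInner α F (swapVars i k E) := by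
    conv_lhs => rw [hEF, polyInner_add_right hα, polyInner_C_mul_right, ← hEF, horth]
    ring
  have h4 : polyInner α (swapVars i k E) (swapVars i k E) = polyInner α E E :=
    polyInner_rename _ _ _
  rw [h3, hEF, polyInner_add_left hα, polyInner_C_mul_left, h4, ← polyInner_swapVars_left, h2]
  push_cast
  ring

/-! ### The closed form under raising and adjacent interchanges -/

/-- The product `∏_{s ∈ η} (α (a(s) + 1) + l(s) + c)`. -/
def armLegProd (α c : ℝ) (η : Fin N → ℕ) : ℝ :=
  ∏ i, ∏ j ∈ Icc 1 (η i), (α * (arm η i j + 1) + leg η i j + c)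

/-- The product `∏_{s ∈ η} (α (a'(s) + 1) + c - l'(s))`. -/
def coarmColegProd (α c : ℝ) (η : Fin N → ℕ) : ℝ :=
  ∏ i, ∏ j ∈ Icc 1 (η i), (α * (coarm j + 1) + c - coleg η i)

/-- The norm ratio `d'_η e_η / (d_η e'_η)`. -/
def normRatio (α : ℝ) (η : Fin N → ℕ) : ℝ := d' α η * e α η / (d α η * e' α η)

theorem normRatio_eq (α : ℝ) (η : Fin N → ℕ) :
    normRatio α η = armLegProd α 0 η * coarmColegProd α N η
      / (armLegProd α 1 η * coarmColegProd α (N - 1) η) := by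
  simp only [normRatio, d, d', e, e', armLegProd, coarmColegProd, add_zero, add_sub_assoc]

theorem leg_eq_sum (η : Fin N → ℕ) (i : Fin N) (j : ℕ) :
    leg η i j = ∑ k, ((if i < k ∧ j ≤ η k ∧ η k ≤ η i then 1 else 0)
      + if k < i ∧ j ≤ η k + 1 ∧ η k + 1 ≤ η i then 1 else 0) := by
  rw [leg, card_filter, card_filter, sum_add_distrib]

theorem leg_raiseComp_castSucc {n : ℕ} (η : Fin (n + 1) → ℕ) (j : Fin n) (m : ℕ) :
    leg (raiseComp η) j.castSucc m = leg η j.succ m := by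
  rw [leg_eq_sum, leg_eq_sum, Fin.sum_univ_castSucc, Fin.sum_univ_succ, add_comm]
  simp only [raiseComp_castSucc, raiseComp_last, Fin.castSucc_lt_castSucc_iff,
    Fin.succ_lt_succ_iff, (Fin.castSucc_lt_last j).not_gt, Fin.succ_pos, true_and, false_and,
    if_false, add_zero, zero_add, Fin.castSucc_lt_last, Fin.not_lt_zero]

theorem leg_raiseComp_last {n : ℕ} (η : Fin (n + 1) → ℕ) (m : ℕ) :
    leg (raiseComp η) (Fin.last n) (m + 1) = leg η 0 m := by
  rw [leg_eq_sum, leg_eq_sum, Fin.sum_univ_castSucc, Fin.sum_univ_succ, add_comm]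
  simp only [raiseComp_castSucc, raiseComp_last, Fin.succ_pos, true_and, false_and, if_false,
    add_zero, zero_add, Fin.castSucc_lt_last, Fin.not_lt_zero, lt_irrefl, add_le_add_iff_right,
    (Fin.castSucc_lt_last _).not_gt]

/-- Each of the other `n` indices is counted exactly once, by the leg if its part is at most `η 0`
and by the colength otherwise. -/
theorem leg_raiseComp_last_one {n : ℕ} (η : Fin (n + 1) → ℕ) :
    leg (raiseComp η) (Fin.last n) 1 + coleg η 0 = n := by
  -- Column `0` lies outside the diagram of `η`, but the formula for the leg still makes sense
  -- there.
  rw [leg_raiseComp_last η 0, leg_eq_sum, coleg_eq_card, card_filter, ← sum_add_distrib,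
    Fin.sum_univ_succ]
  have : ∀ k : Fin n, ((if 0 < k.succ ∧ 0 ≤ η k.succ ∧ η k.succ ≤ η 0 then 1 else 0)
      + (if k.succ < 0 ∧ 0 ≤ η k.succ + 1 ∧ η k.succ + 1 ≤ η 0 then 1 else 0))
      + (if η 0 < η k.succ ∨ (η 0 = η k.succ ∧ k.succ < 0) then 1 else 0) = 1 := fun k => by
    simp only [Fin.succ_pos, Fin.not_lt_zero, true_and, false_and, and_false, or_false, if_false,
      zero_le, add_zero]
    split_ifs <;> omega
  rw [sum_congr rfl fun k _ => this k]
  simp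

theorem prod_Icc_one_succ {M : Type*} [CommMonoid M] (F : ℕ → M) (a : ℕ) :
    ∏ m ∈ Icc 1 (a + 1), F m = F 1 * ∏ m ∈ Icc 1 a, F (m + 1) := by
  induction a with
  | zero => simp
  | succ a ih =>
    rw [prod_Icc_succ_top (by omega), ih, prod_Icc_succ_top (by omega), mul_assoc]

/-- The old first row reappears shifted by one column with the same arms and legs; the extra factor
belongs to the new node in column `1`. -/
theorem armLegProd_raiseComp (α c : ℝ) {n : ℕ} (η : Fin (n + 1) → ℕ) :
    armLegProd α c (raiseComp η)
      = armLegProd α c η * (α * (η 0 + 1) + (n - coleg η 0) + c) := by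
  have hleg : (leg (raiseComp η) (Fin.last n) 1 : ℝ) = n - coleg η 0 := by
    rw [eq_sub_iff_add_eq]
    exact_mod_cast leg_raiseComp_last_one η
  rw [armLegProd, armLegProd, Fin.prod_univ_castSucc, Fin.prod_univ_succ, raiseComp_last,
    prod_Icc_one_succ, hleg]
  simp only [raiseComp_castSucc, leg_raiseComp_castSucc, leg_raiseComp_last, arm, raiseComp_last,
    Nat.add_sub_add_right, Nat.add_sub_cancel]
  ring

/-- Coarms depend on the column alone, so here the extra factor is that of the last node of the row.
-/
theorem coarmColegProd_raiseComp (α c : ℝ) {n : ℕ} (η : Fin (n + 1) → ℕ) :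
    coarmColegProd α c (raiseComp η)
      = coarmColegProd α c η * (α * (η 0 + 1) + c - coleg η 0) := by
  rw [coarmColegProd, coarmColegProd, Fin.prod_univ_castSucc, Fin.prod_univ_succ, raiseComp_last,
    prod_Icc_succ_top (by omega)]
  simp only [raiseComp_castSucc, coleg_raiseComp_castSucc, coleg_raiseComp_last, coarm,
    Nat.add_sub_cancel]
  ring

theorem normRatio_raiseComp (hα : 0 < α) {n : ℕ} (η : Fin (n + 1) → ℕ) :
    normRatio α (raiseComp η) = normRatio α η := by
  have hle : (coleg η 0 : ℝ) ≤ n := by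
    have := leg_raiseComp_last_one η
    exact_mod_cast (by omega : coleg η 0 ≤ n)
  have h0 : 0 < α * ((η 0 : ℝ) + 1) := by positivity
  rw [normRatio_eq, normRatio_eq, armLegProd_raiseComp, armLegProd_raiseComp,
    coarmColegProd_raiseComp, coarmColegProd_raiseComp]
  push_cast
  set A := α * ((η 0 : ℝ) + 1) + (n - coleg η 0) with hA
  have hApos : 0 < A := by rw [hA]; linarith
  have e1 : α * ((η 0 : ℝ) + 1) + (n + 1) - coleg η 0 = A + 1 := by rw [hA]; ring
  have e2 : α * ((η 0 : ℝ) + 1) + (n + 1 - 1) - coleg η 0 = A := by rw [hA]; ring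
  rw [e1, e2, add_zero]
  have hne : A * (A + 1) ≠ 0 := by positivity
  refine Eq.trans ?_ (mul_div_mul_right _ _ hne)
  congr 1 <;> ring

theorem coarmColegProd_comp_swap (α c : ℝ) {η : Fin N → ℕ} {i k : Fin N}
    (hk : (k : ℕ) = i + 1) (h : η k < η i) :
    coarmColegProd α c (η ∘ Equiv.swap i k) = coarmColegProd α c η := by
  rw [coarmColegProd, coarmColegProd, ← Equiv.prod_comp (Equiv.swap i k)]
  simp only [coleg_comp_swap hk h, Function.comp, Equiv.swap_apply_self]

/-- After the interchange the shorter row precedes the longer one, and preceding rows enter the leg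
with their length increased by `1`. This adds the single column `η k + 1`. -/
theorem leg_comp_swap {η : Fin N → ℕ} {i k : Fin N} (hk : (k : ℕ) = i + 1) (h : η k < η i)
    (j : Fin N) (m : ℕ) :
    leg (η ∘ Equiv.swap i k) (Equiv.swap i k j) m
      = leg η j m + if j = i ∧ m = η k + 1 then 1 else 0 := by
  have hsum : (if j = i ∧ m = η k + 1 then 1 else 0)
      = ∑ p, if p = k then (if j = i ∧ m = η k + 1 then 1 else 0) else 0 := by simp
  rw [leg_eq_sum, leg_eq_sum, ← Equiv.sum_comp (Equiv.swap i k), hsum, ← sum_add_distrib]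
  refine sum_congr rfl fun p _ => ?_
  simp only [Function.comp, Equiv.swap_apply_self]
  have hik : (i : ℕ) < k := by omega
  rcases eq_or_ne p k with rfl | hpk
  · rw [Equiv.swap_apply_right]
    rcases eq_or_ne j i with rfl | hji
    · rw [Equiv.swap_apply_left]
      simp only [Fin.lt_def, true_and, if_true]
      split_ifs <;> omega
    rcases eq_or_ne j p with rfl | hjp
    · rw [Equiv.swap_apply_right]
      simp [hji]
    · rw [Equiv.swap_apply_of_ne_of_ne hji hjp]
      simp only [Fin.lt_def, hji, false_and, if_false, if_true, add_zero]
      have h1 : (j : ℕ) ≠ i := fun h => hji (Fin.ext h)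
      have h2 : (j : ℕ) ≠ p := fun h => hjp (Fin.ext h)
      have h3 : (j : ℕ) < i ↔ (j : ℕ) < p := by omega
      have h4 : (i : ℕ) < j ↔ (p : ℕ) < j := by omega
      simp only [h3, h4]
  · rw [if_neg hpk, add_zero]
    have hp1 : (p : ℕ) ≠ k := fun h => hpk (Fin.ext h)
    rcases eq_or_ne p i with rfl | hpi
    · rw [Equiv.swap_apply_left]
      rcases eq_or_ne j p with rfl | hji
      · rw [Equiv.swap_apply_left]
        simp
      rcases eq_or_ne j k with rfl | hjk
      · rw [Equiv.swap_apply_right]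
        simp only [Fin.lt_def]
        split_ifs <;> omega
      · rw [Equiv.swap_apply_of_ne_of_ne hji hjk]
        have h1 : (j : ℕ) ≠ p := fun h => hji (Fin.ext h)
        have h2 : (j : ℕ) ≠ k := fun h => hjk (Fin.ext h)
        have h3 : (j : ℕ) < k ↔ (j : ℕ) < p := by omega
        have h4 : (k : ℕ) < j ↔ (p : ℕ) < j := by omega
        simp only [Fin.lt_def, h3, h4]
    · rw [Equiv.swap_apply_of_ne_of_ne hpi hpk]
      have hp2 : (p : ℕ) ≠ i := fun h => hpi (Fin.ext h)
      have h3 : ((Equiv.swap i k j : Fin N) : ℕ) < p ↔ (j : ℕ) < p := by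
        rw [Equiv.swap_apply_def]; split_ifs <;> simp_all only <;> omega
      have h4 : (p : ℕ) < (Equiv.swap i k j : Fin N) ↔ (p : ℕ) < j := by
        rw [Equiv.swap_apply_def]; split_ifs <;> simp_all only <;> omega
      simp only [Fin.lt_def, h3, h4]

/-- The leg at column `η k + 1` counts the indices ranked strictly between `i` and `k`; the final
`1` is `i` itself. -/
theorem coleg_add_leg {η : Fin N → ℕ} {i k : Fin N} (hk : (k : ℕ) = i + 1) (h : η k < η i) :
    coleg η k = coleg η i + leg η i (η k + 1) + 1 := by
  have hsum : 1 = ∑ m : Fin N, if m = i then 1 else 0 := by simp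
  rw [coleg_eq_card, coleg_eq_card, card_filter, card_filter, leg_eq_sum]
  conv_rhs => rw [hsum]
  rw [← sum_add_distrib, ← sum_add_distrib]
  refine sum_congr rfl fun m _ => ?_
  simp only [Fin.lt_def]
  rcases eq_or_ne m i with rfl | hmi
  · simp only [if_true]
    split_ifs <;> omega
  rcases eq_or_ne m k with rfl | hmk
  · simp only [hmi, if_false]
    split_ifs <;> omega
  have h1 : (m : ℕ) ≠ i := fun h => hmi (Fin.ext h)
  have h2 : (m : ℕ) ≠ k := fun h => hmk (Fin.ext h)
  simp only [hmi, if_false]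
  split_ifs <;> omega

theorem eigval_sub_eigval {η : Fin N → ℕ} {i k : Fin N} (hk : (k : ℕ) = i + 1) (h : η k < η i) :
    eigval α η i - eigval α η k
      = α * (arm η i (η k + 1) + 1) + leg η i (η k + 1) + 1 := by
  have harm : (arm η i (η k + 1) : ℝ) = η i - (η k + 1) := by
    rw [arm, Nat.cast_sub (by omega)]; push_cast; ring
  rw [eigval, eigval, coleg_add_leg hk h, harm]
  push_cast
  ring

/-- Only the factor at row `i`, column `η k + 1` changes. With `δ` the eigenvalue difference it is
`δ - 1 + c` for `η` and `δ + c` after the interchange. -/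
theorem armLegProd_comp_swap (α c : ℝ) {η : Fin N → ℕ} {i k : Fin N}
    (hk : (k : ℕ) = i + 1) (h : η k < η i) :
    armLegProd α c (η ∘ Equiv.swap i k) * (eigval α η i - eigval α η k - 1 + c)
      = armLegProd α c η * (eigval α η i - eigval α η k + c) := by
  rw [eigval_sub_eigval hk h, armLegProd, armLegProd, ← Equiv.prod_comp (Equiv.swap i k)]
  simp only [leg_comp_swap hk h, arm, Function.comp, Equiv.swap_apply_self]
  rw [← mul_prod_erase _ _ (mem_univ i), ← mul_prod_erase _ _ (mem_univ i)]
  have hm : η k + 1 ∈ Icc 1 (η i) := mem_Icc.mpr ⟨by omega, h⟩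
  rw [← mul_prod_erase _ _ hm, ← mul_prod_erase _ _ hm]
  have h1 : ∏ m ∈ (Icc 1 (η i)).erase (η k + 1), (α * (((η i - m : ℕ) : ℝ) + 1)
        + ((leg η i m + if i = i ∧ m = η k + 1 then 1 else 0 : ℕ) : ℝ) + c)
      = ∏ m ∈ (Icc 1 (η i)).erase (η k + 1), (α * (((η i - m : ℕ) : ℝ) + 1) + leg η i m + c) :=
    prod_congr rfl fun m hm => by rw [if_neg fun h => (mem_erase.mp hm).1 h.2, add_zero]
  have h2 : ∏ j ∈ univ.erase i, ∏ m ∈ Icc 1 (η j), (α * (((η j - m : ℕ) : ℝ) + 1)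
        + ((leg η j m + if j = i ∧ m = η k + 1 then 1 else 0 : ℕ) : ℝ) + c)
      = ∏ j ∈ univ.erase i, ∏ m ∈ Icc 1 (η j), (α * (((η j - m : ℕ) : ℝ) + 1) + leg η j m + c) :=
    prod_congr rfl fun j hj => prod_congr rfl fun m _ => by
      rw [if_neg fun h => (mem_erase.mp hj).1 h.1, add_zero]
  rw [h1, h2, if_pos ⟨rfl, rfl⟩]
  push_cast
  ring

theorem normRatio_comp_swap (hα : 0 < α) {η : Fin N → ℕ} {i k : Fin N}
    (hk : (k : ℕ) = i + 1) (h : η k < η i) :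
    normRatio α η = normRatio α (η ∘ Equiv.swap i k)
      * (1 - (1 / (eigval α η i - eigval α η k)) ^ 2) := by
  have h0 := armLegProd_comp_swap α 0 hk h
  have h1 := armLegProd_comp_swap α 1 hk h
  have hδ := eigval_sub_eigval (α := α) hk h
  rw [normRatio_eq, normRatio_eq, coarmColegProd_comp_swap α _ hk h,
    coarmColegProd_comp_swap α _ hk h]
  set δ := eigval α η i - eigval α η k with hδdef
  have hδ1 : 1 < δ := by
    rw [hδ]
    have : 0 < α * ((arm η i (η k + 1) : ℝ) + 1) := by positivity
    have : (0 : ℝ) ≤ leg η i (η k + 1) := Nat.cast_nonneg _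
    linarith
  have hδ0 : δ ≠ 0 := by linarith
  have hδ2 : δ + 1 ≠ 0 := by linarith
  have e0 : armLegProd α 0 η = armLegProd α 0 (η ∘ Equiv.swap i k) * ((δ - 1) / δ) := by
    rw [mul_div_assoc', eq_div_iff hδ0]
    linear_combination -h0
  have e1 : armLegProd α 1 η = armLegProd α 1 (η ∘ Equiv.swap i k) * (δ / (δ + 1)) := by
    rw [mul_div_assoc', eq_div_iff hδ2]
    linear_combination -h1
  rw [e0, e1]
  field_simp
  ring

/-! ### The norm formula -/

theorem jackNorm_zero_ne_zero (hα : 0 < α) : jackNorm α (0 : Fin N → ℕ) ≠ 0 := by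
  rw [jackNorm_eq]
  exact polyInner_self_ne_zero hα (jackE_ne_zero hα 0)

theorem normRatio_zero (α : ℝ) : normRatio α (0 : Fin N → ℕ) = 1 := by
  simp [normRatio, d, d', e, e']

theorem exists_eq_raiseComp {n : ℕ} {η : Fin (n + 1) → ℕ} (h : η (Fin.last n) ≠ 0) :
    ∃ ν, η = raiseComp ν := by
  refine ⟨Fin.cons (α := fun _ => ℕ) (η (Fin.last n) - 1) fun j => η j.castSucc, funext fun k => ?_⟩
  refine Fin.lastCases ?_ (fun j => ?_) k
  · rw [raiseComp_last, Fin.cons_zero]; omega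
  · rw [raiseComp_castSucc, Fin.cons_succ]

/-- The last nonzero part is followed by a zero. -/
theorem exists_adjacent_descent {n : ℕ} {η : Fin (n + 1) → ℕ} (h : η (Fin.last n) = 0)
    (h0 : η ≠ 0) : ∃ i k : Fin (n + 1), (k : ℕ) = i + 1 ∧ η k < η i := by
  obtain ⟨j, hj⟩ := Function.ne_iff.mp h0
  obtain ⟨i, hi, hmax⟩ := exists_max_image {j | η j ≠ 0} (id : Fin (n + 1) → _)
    ⟨j, by simpa using hj⟩
  simp only [mem_filter, mem_univ, true_and, id] at hi hmax
  have hlast : (i : ℕ) ≠ n := fun hn => hi (by rwa [show i = Fin.last n from Fin.ext hn])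
  refine ⟨i, ⟨i + 1, by omega⟩, rfl, ?_⟩
  have hz : η ⟨i + 1, by omega⟩ = 0 := by
    by_contra hne
    have := hmax _ hne
    rw [Fin.le_def] at this
    simp at this
  omega

theorem sum_weighted_comp_swap_lt {η : Fin N → ℕ} {i k : Fin N} (hk : (k : ℕ) = i + 1)
    (h : η k < η i) :
    ∑ j : Fin N, (N - (j : ℕ)) * (η ∘ Equiv.swap i k) j < ∑ j : Fin N, (N - (j : ℕ)) * η j := by
  have hik : i ≠ k := fun h' => by rw [h'] at hk; omega
  rw [sum_eq_pair_add hik, sum_eq_pair_add hik]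
  have hrest : ∑ j ∈ (univ.erase i).erase k, (N - (j : ℕ)) * (η ∘ Equiv.swap i k) j
      = ∑ j ∈ (univ.erase i).erase k, (N - (j : ℕ)) * η j := sum_congr rfl fun j hj => by
    simp only [mem_erase] at hj
    rw [Function.comp_apply, Equiv.swap_apply_of_ne_of_ne hj.2.1 hj.1]
  rw [hrest, ← add_assoc, ← add_assoc]
  refine Nat.add_lt_add_right ?_ _
  have hN : N - (i : ℕ) = (N - (k : ℕ)) + 1 := by have := k.2; omega
  simp only [Function.comp_apply, Equiv.swap_apply_left, Equiv.swap_apply_right, hN]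
  nlinarith

theorem jackNorm_eq_mul_normRatio (hα : 0 < α) (η : Fin N → ℕ) :
    jackNorm α η = jackNorm α (0 : Fin N → ℕ) * (normRatio α η : ℂ) := by
  rcases N with _ | n
  · rw [Subsingleton.elim η 0, normRatio_zero]; simp
  -- Undoing a raising lowers the modulus. An interchange keeps it but lowers the sum weighted by `n
  -- + 1 - j`, which serves as the inner induction.
  induction hs : ∑ j, η j using Nat.strong_induction_on generalizing η with
  | _ s ihs =>
  induction hM : ∑ j : Fin (n + 1), (n + 1 - (j : ℕ)) * η j using Nat.strong_induction_on
    generalizing η with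
  | _ M ihM =>
  by_cases hlast : η (Fin.last n) = 0
  · by_cases h0 : η = 0
    · rw [h0, normRatio_zero]; simp
    · obtain ⟨i, k, hk, hlt⟩ := exists_adjacent_descent hlast h0
      rw [jackNorm_comp_swap hα hk hlt, normRatio_comp_swap hα hk hlt,
        ihM _ (hM ▸ sum_weighted_comp_swap_lt hk hlt)
          (η ∘ Equiv.swap i k)
          ((Equiv.sum_comp (Equiv.swap i k) η).trans hs) rfl]
      push_cast
      ring
  · obtain ⟨ν, rfl⟩ := exists_eq_raiseComp hlast
    have hsum : ∑ j, ν j < s := by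
      rw [← hs, Fin.sum_univ_castSucc (raiseComp ν), Fin.sum_univ_succ ν]
      simp only [raiseComp_castSucc, raiseComp_last]
      omega
    rw [jackNorm_raiseComp hα, normRatio_raiseComp hα, ihs _ hsum ν rfl]

end NonsymJack

end

theorem proposition2p4 (N : ℕ) (α : ℝ) (hα : 0 < α) (η : Fin N → ℕ) :
    (∃! E : MvPolynomial (Fin N) ℝ, NonsymJack.IsNonsymJack α η E) ∧
      NonsymJack.jackNorm α η / NonsymJack.jackNorm α (0 : Fin N → ℕ) =
        ((NonsymJack.d' α η * NonsymJack.e α η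
          / (NonsymJack.d α η * NonsymJack.e' α η) : ℝ) : ℂ) := by
  refine ⟨NonsymJack.existsUnique_isNonsymJack hα η, ?_⟩
  rw [NonsymJack.jackNorm_eq_mul_normRatio hα η,
    mul_div_cancel_left₀ _ (NonsymJack.jackNorm_zero_ne_zero hα)]
  rfl
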